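/- An instance of the offline knapsack problem under explorable uncertainty consists of items $\mathcal I=\{1,\dots,n\}$, a capacity $B\in\mathbb N$, weights $w_i\in\mathbb N$ with $w_i\le B$, profits $p_i\in\mathbb R_{\ge 0}$, and for each item an interval $I_i\ni p_i$ that is either trivial, $I_i=\{p_i\}$ (then put $L_i=U_i=p_i$), or open, $I_i=(L_i,U_i)$; all of these data are known to the algorithm. Let $\mathcal I_T$ be the set of trivial items. A packing is a set $P\subseteq\mathcal I$ with $\sum_{i\in P}w_i\le B$; write $p(P)=\sum_{i\in P}p_i$, and let $p^*$ be the maximum of $p(P)$ over all packings. A query set $Q\subseteq\mathcal I$ is feasible if (1) some packing $P\subseteq Q\cup\mathcal I_T$ has $p(P)=p^*$, and (2) $\sum_{i\in P\setminus Q}U_i+\sum_{i\in P\cap Q}p_i\le p^*$ for every packing $P$. Let $Q^*$ be a feasible query set of minimum cardinality. Fix $\varepsilon>0$. There is a polynomial-time algorithm that, given an instance, computes a packing $P$ with $$p(P)\ge(1-\varepsilon)\,p^*\qquad\text{and}\qquad |P\setminus\mathcal I_T|\le|Q^*|.$$ Here an algorithm is a random access program (assignments, sequencing, branching, while loops) over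 arrays of natural numbers, with $+$, truncated $-$, $\times$ and comparison, and arrays of real numbers, with $+$, $-$ and comparison only. Each operation costs one plus the length of its result, where the length of a natural number is its number of binary digits. One and the same program is polynomial in both of the following senses: on instances with rational $p_i,L_i,U_i$, its total cost is at most a polynomial in the binary encoding length of the instance, where the length of a rational number is its binary length (logarithmic cost); and on all instances with real $p_i,L_i,U_i$, its total cost is at most a polynomial in the length of the instance when every real number is counted with length one. -/

import Mathlib

namespace OfflineKnap

/-! ### Knapsack instances with uncertain profits -/

/-- An instance: `n` items, capacity `B`, natural weights at most `B`, nonnegative real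
profits, and for every item an uncertainty interval containing the profit.  The interval is
either the singleton of the profit (then both limits equal the profit), or the open interval
between the lower limit `lo i` and the upper limit `hi i`. -/
structure KnapInstance where
  n : ℕ
  B : ℕ
  w : Fin n → ℕ
  w_le : ∀ i, w i ≤ B
  p : Fin n → ℝ
  p_nonneg : ∀ i, 0 ≤ p i
  lo : Fin n → ℝ
  hi : Fin n → ℝ
  interval : ∀ i, (lo i = p i ∧ hi i = p i) ∨ (lo i < p i ∧ p i < hi i)

namespace KnapInstance

variable (K : KnapInstance)

/-- The set of trivial items, those whose interval is a singleton. -/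
noncomputable def trivialItems : Finset (Fin K.n) :=
  Finset.univ.filter fun i => K.lo i = K.hi i

/-- `P` is a packing: its total weight is at most the capacity. -/
def IsPacking (P : Finset (Fin K.n)) : Prop := ∑ i ∈ P, K.w i ≤ K.B

instance : DecidablePred K.IsPacking := fun P =>
  inferInstanceAs (Decidable (∑ i ∈ P, K.w i ≤ K.B))

/-- The finite set of all packings. -/
def packings : Finset (Finset (Fin K.n)) := Finset.univ.filter K.IsPacking

theorem packings_nonempty : K.packings.Nonempty :=
  ⟨∅, by simp [packings, IsPacking]⟩

/-- The profit of a set of items. -/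
noncomputable def profit (P : Finset (Fin K.n)) : ℝ := ∑ i ∈ P, K.p i

/-- The optimal profit: the maximum profit over all packings. -/
noncomputable def optProfit : ℝ := K.packings.sup' K.packings_nonempty K.profit

/-- The upper limit of item `i` after querying `Q`. -/
noncomputable def upperItem (Q : Finset (Fin K.n)) (i : Fin K.n) : ℝ :=
  if i ∈ Q then K.p i else K.hi i

/-- The upper limit of the set `P` after querying `Q`. -/
noncomputable def upper (Q P : Finset (Fin K.n)) : ℝ := ∑ i ∈ P, K.upperItem Q i

/-- Feasible query sets. -/
def IsFeasible (Q : Finset (Fin K.n)) : Prop :=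
  (∃ P, K.IsPacking P ∧ P ⊆ Q ∪ K.trivialItems ∧ K.profit P = K.optProfit) ∧
    ∀ P, K.IsPacking P → K.upper Q P ≤ K.optProfit

/-- Feasible query sets of minimum cardinality. -/
def IsOptimalQuerySet (Q : Finset (Fin K.n)) : Prop :=
  K.IsFeasible Q ∧ ∀ Q', K.IsFeasible Q' → Q.card ≤ Q'.card

theorem isFeasible_univ : K.IsFeasible Finset.univ := by
  refine ⟨?_, fun P hP => ?_⟩
  · obtain ⟨P, hP, h⟩ := K.packings.exists_mem_eq_sup' K.packings_nonempty K.profit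
    exact ⟨P, by simpa [packings] using hP, fun i _ => by simp, h.symm⟩
  · have h : K.upper Finset.univ P = K.profit P := by simp [upper, upperItem, profit]
    rw [h]
    exact Finset.le_sup' K.profit (by simpa [packings] using hP)

theorem exists_isOptimalQuerySet : ∃ Q, K.IsOptimalQuerySet Q := by
  classical
  obtain ⟨Q, hQ, hmin⟩ := Finset.exists_min_image (Finset.univ.filter K.IsFeasible)
    Finset.card ⟨Finset.univ, by simpa using K.isFeasible_univ⟩
  exact ⟨Q, by simpa using hQ, fun Q' h => hmin Q' (by simpa using h)⟩

/-- All profits and interval limits are rational numbers. -/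
def IsRational : Prop :=
  ∀ i, (∃ q : ℚ, (q : ℝ) = K.p i) ∧ (∃ q : ℚ, (q : ℝ) = K.lo i) ∧ ∃ q : ℚ, (q : ℝ) = K.hi i

end KnapInstance

/-! ### Random access programs and their cost

The memory consists of arrays of natural numbers and arrays of real numbers.  A program is
a finite piece of text, so it names finitely many arrays; the index inside an array is
computed at run time. -/

/-- A memory state: `nat a i` is cell `i` of the `a`-th array of natural numbers, and
`num a i` is cell `i` of the `a`-th array of real numbers. -/
structure State where
  nat : ℕ → ℕ → ℕ
  num : ℕ → ℕ → ℝ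

/-- Expressions for natural numbers: constants, memory access and arithmetic. -/
inductive NExpr where
  | const (k : ℕ)
  | get (a : ℕ) (i : NExpr)
  | add (e f : NExpr)
  | sub (e f : NExpr)
  | mul (e f : NExpr)

/-- Expressions for real numbers: zero, memory access, addition and subtraction. -/
inductive RExpr where
  | zero
  | get (a : ℕ) (i : NExpr)
  | add (u v : RExpr)
  | sub (u v : RExpr)

/-- Tests: comparisons and their Boolean combinations. -/
inductive Test where
  | natLe (e f : NExpr)
  | numLe (u v : RExpr)
  | neg (b : Test)
  | conj (b c : Test)

/-- Programs. -/
inductive Prog where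
  | skip
  | setNat (a : ℕ) (i : NExpr) (e : NExpr)
  | setNum (a : ℕ) (i : NExpr) (u : RExpr)
  | seq (A A' : Prog)
  | ite (b : Test) (A A' : Prog)
  | loop (b : Test) (A : Prog)

/-- Value of an expression; subtraction of natural numbers is truncated at zero. -/
def NExpr.val (s : State) : NExpr → ℕ
  | .const k => k
  | .get a i => s.nat a (i.val s)
  | .add e f => e.val s + f.val s
  | .sub e f => e.val s - f.val s
  | .mul e f => e.val s * f.val s

/-- Value of a real expression. -/
noncomputable def RExpr.val (s : State) : RExpr → ℝ
  | .zero => 0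
  | .get a i => s.num a (i.val s)
  | .add u v => u.val s + v.val s
  | .sub u v => u.val s - v.val s

/-- Truth of a test. -/
def Test.Holds (s : State) : Test → Prop
  | .natLe e f => e.val s ≤ f.val s
  | .numLe u v => u.val s ≤ v.val s
  | .neg b => ¬ b.Holds s
  | .conj b c => b.Holds s ∧ c.Holds s

/-- Cost of evaluating an expression: every operation costs one plus the binary length of
its result (the operands are themselves results of operations that are charged). -/
def NExpr.cost (s : State) : NExpr → ℕ
  | .const k => 1 + Nat.size k
  | .get a i => i.cost s + (1 + Nat.size (s.nat a (i.val s)))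
  | .add e f => e.cost s + f.cost s + (1 + Nat.size (e.val s + f.val s))
  | .sub e f => e.cost s + f.cost s + (1 + Nat.size (e.val s - f.val s))
  | .mul e f => e.cost s + f.cost s + (1 + Nat.size (e.val s * f.val s))

/-- Cost of evaluating a real expression, when a real number `x` has length `size x`. -/
noncomputable def RExpr.cost (size : ℝ → ℕ) (s : State) : RExpr → ℕ
  | .zero => 1 + size 0
  | .get a i => i.cost s + (1 + size (s.num a (i.val s)))
  | .add u v => u.cost size s + v.cost size s + (1 + size (u.val s + v.val s))
  | .sub u v => u.cost size s + v.cost size s + (1 + size (u.val s - v.val s))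

/-- Cost of evaluating a test. -/
noncomputable def Test.cost (size : ℝ → ℕ) (s : State) : Test → ℕ
  | .natLe e f => 1 + e.cost s + f.cost s
  | .numLe u v => 1 + u.cost size s + v.cost size s
  | .neg b => 1 + b.cost size s
  | .conj b c => 1 + b.cost size s + c.cost size s

/-- Overwrite one cell of an array of natural numbers. -/
def State.writeNat (s : State) (a i x : ℕ) : State :=
  { s with nat := Function.update s.nat a (Function.update (s.nat a) i x) }

/-- Overwrite one cell of an array of real numbers. -/
noncomputable def State.writeNum (s : State) (a i : ℕ) (x : ℝ) : State :=
  { s with num := Function.update s.num a (Function.update (s.num a) i x) }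

/-- `Exec size A s t s'`: started in state `s`, the program `A` halts in state `s'` after a
run of total cost `t`. -/
inductive Exec (size : ℝ → ℕ) : Prog → State → ℕ → State → Prop where
  | skip (s : State) : Exec size .skip s 1 s
  | setNat (a : ℕ) (i e : NExpr) (s : State) :
      Exec size (.setNat a i e) s (1 + i.cost s + e.cost s) (s.writeNat a (i.val s) (e.val s))
  | setNum (a : ℕ) (i : NExpr) (u : RExpr) (s : State) :
      Exec size (.setNum a i u) s (1 + i.cost s + u.cost size s)
        (s.writeNum a (i.val s) (u.val s))
  | seq {A A' : Prog} {s s₁ s₂ : State} {t t' : ℕ} :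
      Exec size A s t s₁ → Exec size A' s₁ t' s₂ → Exec size (.seq A A') s (t + t') s₂
  | iteTrue {b : Test} {A A' : Prog} {s s₁ : State} {t : ℕ} :
      b.Holds s → Exec size A s t s₁ → Exec size (.ite b A A') s (b.cost size s + t) s₁
  | iteFalse {b : Test} {A A' : Prog} {s s₁ : State} {t : ℕ} :
      ¬ b.Holds s → Exec size A' s t s₁ → Exec size (.ite b A A') s (b.cost size s + t) s₁
  | loopTrue {b : Test} {A : Prog} {s s₁ s₂ : State} {t t' : ℕ} :
      b.Holds s → Exec size A s t s₁ → Exec size (.loop b A) s₁ t' s₂ →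
        Exec size (.loop b A) s (b.cost size s + t + t') s₂
  | loopFalse {b : Test} {A : Prog} {s : State} :
      ¬ b.Holds s → Exec size (.loop b A) s (b.cost size s) s

/-- Unit length for every real number. -/
def unitSize (_ : ℝ) : ℕ := 1

/-- The binary length of a rational number: one sign bit, the numerator, the denominator. -/
def ratSize (q : ℚ) : ℕ := 1 + Nat.size q.num.natAbs + Nat.size q.den

open Classical in
/-- The binary length of a real number that is rational.  The value at irrational numbers is
irrelevant: this length is only used for runs on rational data, where no such number occurs. -/
noncomputable def bitSize (x : ℝ) : ℕ :=
  if h : ∃ q : ℚ, (q : ℝ) = x then ratSize h.choose else 0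

theorem bitSize_ratCast (q : ℚ) : bitSize (q : ℝ) = ratSize q := by
  have h : ∃ r : ℚ, (r : ℝ) = (q : ℝ) := ⟨q, rfl⟩
  rw [bitSize, dif_pos h]
  congr 1
  exact_mod_cast h.choose_spec

/-! ### Algorithms for knapsack instances -/

namespace KnapInstance

variable (K : KnapInstance)

/-- Extend a vector by zeros. -/
def extend {α : Type} [Zero α] {n : ℕ} (v : Fin n → α) (i : ℕ) : α :=
  if h : i < n then v ⟨i, h⟩ else 0

/-- The initial memory: the natural arrays `0`, `1`, `2` hold the number of items, the capacity
and the weights; the real arrays `0`, `1`, `2` hold the profits, the lower limits and the upper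
limits; every other cell is zero. -/
noncomputable def input : State where
  nat a i :=
    if a = 0 ∧ i = 0 then K.n
    else if a = 1 ∧ i = 0 then K.B
    else if a = 2 then extend K.w i
    else 0
  num a i :=
    if a = 0 then extend K.p i
    else if a = 1 then extend K.lo i
    else if a = 2 then extend K.hi i
    else 0

/-- The set of items that is read off a memory state: natural array `3` holds its indicator. -/
def output (s : State) : Finset (Fin K.n) := Finset.univ.filter fun i => s.nat 3 i ≠ 0

/-- The length of the input, when a real number `x` has length `size x`. -/
noncomputable def length (size : ℝ → ℕ) : ℕ :=
  K.n + Nat.size K.B + ∑ i, (Nat.size (K.w i) + size (K.p i) + size (K.lo i) + size (K.hi i))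

end KnapInstance

/-- On every instance in `dom`, the program `A` halts with an output that satisfies `goal`, at a
cost that is bounded by a fixed polynomial in the length of the input. -/
def SolvesInPolyTime (size : ℝ → ℕ) (dom : KnapInstance → Prop)
    (goal : (K : KnapInstance) → Finset (Fin K.n) → Prop) (A : Prog) : Prop :=
  ∃ T : Polynomial ℕ, ∀ K : KnapInstance, dom K → ∃ (t : ℕ) (s : State),
    Exec size A K.input t s ∧ t ≤ T.eval (K.length size) ∧ goal K (K.output s)

/-- `P` is a packing of profit at least `(1 - ε)` times the optimal profit, with at most as many
nontrivial items as an optimal query set has elements. -/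
def IsSmallPacking (ε : ℝ) (K : KnapInstance) (P : Finset (Fin K.n)) : Prop :=
  K.IsPacking P ∧ (1 - ε) * K.optProfit ≤ K.profit P ∧
    ∀ Q, K.IsOptimalQuerySet Q → (P \ K.trivialItems).card ≤ Q.card

end OfflineKnap

/-! The link to queries is short: a feasible query set `Q` contains all nontrivial items of some
optimal packing `P'`, so `P'` has at most `|Q|` nontrivial items. Hence it is enough to minimize the
number of nontrivial items over a class of almost optimal packings, provided that this class
contains every optimal packing.

Such a class comes from rounding. Let `pm` be the largest profit and `M = m * n` with `m ≥ 2 / ε`,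
and let `v i` be `M * p i / pm` rounded up. The rounding error of a set is at most `n` units of size
`pm / M`. If `V` is the largest rounded profit of a packing, every optimal packing has rounded
profit at least `V - n`. Conversely, a packing with rounded profit at least `V - n` loses at most `2
* n` units, that is `2 * pm / m ≤ ε * p*`, because `pm ≤ p*`. This is `isSmallPacking_of_selection`.
A table indexed by the number of nontrivial items and the rounded profit, with the least weight as
its content, gives `V`, then the least count, and by backtracking a packing (`le_table`,
`exists_of_table_pos`, `backLoop_ensures`).

The machine cannot multiply or divide reals. Since `M` is polynomial in `n`, multiples are formed by
repeated addition and the quotient is found by counting. The number of steps thus depends on `m` and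
`n` alone (`knapProg_ensures`, `stepBound`).

Steps become cost through `Run.exists_exec`: the program stores no products of naturals, so each
step lengthens the cells by at most a constant. For rational data all reals are kept over one common
denominator, whose length is linear in that of the input; each addition then adds one bit to a
numerator (`lengthControl_bitSize`). With unit lengths nothing has to be controlled. Both cost
models are instances of `LengthControl`, and so one program serves both. -/

namespace OfflineKnap

/-! ### Unit cost runs -/

/-- `Run A s k s'`: started in `s`, the program `A` halts in `s'` after `k` elementary steps. -/
inductive Run : Prog → State → ℕ → State → Prop where
  | skip (s : State) : Run .skip s 1 s
  | setNat (a : ℕ) (i e : NExpr) (s : State) :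
      Run (.setNat a i e) s 1 (s.writeNat a (i.val s) (e.val s))
  | setNum (a : ℕ) (i : NExpr) (u : RExpr) (s : State) :
      Run (.setNum a i u) s 1 (s.writeNum a (i.val s) (u.val s))
  | seq {A A' : Prog} {s s₁ s₂ : State} {k k' : ℕ} :
      Run A s k s₁ → Run A' s₁ k' s₂ → Run (.seq A A') s (k + k') s₂
  | iteTrue {b : Test} {A A' : Prog} {s s₁ : State} {k : ℕ} :
      b.Holds s → Run A s k s₁ → Run (.ite b A A') s (k + 1) s₁
  | iteFalse {b : Test} {A A' : Prog} {s s₁ : State} {k : ℕ} :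
      ¬ b.Holds s → Run A' s k s₁ → Run (.ite b A A') s (k + 1) s₁
  | loopTrue {b : Test} {A : Prog} {s s₁ s₂ : State} {k k' : ℕ} :
      b.Holds s → Run A s k s₁ → Run (.loop b A) s₁ k' s₂ → Run (.loop b A) s (1 + k + k') s₂
  | loopFalse {b : Test} {A : Prog} {s : State} : ¬ b.Holds s → Run (.loop b A) s 1 s

/-- Number of nodes of an expression, constants being counted with their length. -/
def NExpr.width : NExpr → ℕ
  | .const k => 1 + Nat.size k
  | .get _ i => 1 + i.width
  | .add e f => 1 + e.width + f.width
  | .sub e f => 1 + e.width + f.width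
  | .mul e f => 1 + e.width + f.width

/-- Number of nodes of a real expression. -/
def RExpr.width : RExpr → ℕ
  | .zero => 1
  | .get _ i => 1 + i.width
  | .add u v => 1 + u.width + v.width
  | .sub u v => 1 + u.width + v.width

/-- Number of nodes of a test. -/
def Test.width : Test → ℕ
  | .natLe e f => 1 + e.width + f.width
  | .numLe u v => 1 + u.width + v.width
  | .neg b => 1 + b.width
  | .conj b c => 1 + b.width + c.width

/-- Number of nodes of a program. -/
def Prog.width : Prog → ℕ
  | .skip => 1
  | .setNat _ i e => 1 + i.width + e.width
  | .setNum _ i u => 1 + i.width + u.width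
  | .seq A A' => 1 + A.width + A'.width
  | .ite b A A' => 1 + b.width + A.width + A'.width
  | .loop b A => 1 + b.width + A.width

/-- The expression is free of multiplications, except inside array indices. -/
def NExpr.Additive : NExpr → Prop
  | .const _ => True
  | .get _ _ => True
  | .add e f => e.Additive ∧ f.Additive
  | .sub e f => e.Additive ∧ f.Additive
  | .mul _ _ => False

/-- All values that the program stores in natural arrays come from additive expressions. -/
def Prog.Additive : Prog → Prop
  | .skip => True
  | .setNat _ _ e => e.Additive
  | .setNum _ _ _ => True
  | .seq A A' => A.Additive ∧ A'.Additive
  | .ite _ A A' => A.Additive ∧ A'.Additive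
  | .loop _ A => A.Additive

/-- `Len S x` says that `x` has complexity at most `S`; every addition or subtraction raises the
complexity by at most one, and it controls the length `size`. -/
structure LengthControl (size : ℝ → ℕ) (d : ℕ) (Len : ℕ → ℝ → Prop) : Prop where
  mono : ∀ {S S' x}, S ≤ S' → Len S x → Len S' x
  zero : ∀ S, Len S 0
  add : ∀ {S x y}, Len S x → Len S y → Len (S + 1) (x + y)
  sub : ∀ {S x y}, Len S x → Len S y → Len (S + 1) (x - y)
  size_le : ∀ {S x}, Len S x → size x ≤ S + d

/-- All cells of the memory have complexity at most `S`. -/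
def State.Bounded (Len : ℕ → ℝ → Prop) (S : ℕ) (s : State) : Prop :=
  (∀ a i, Nat.size (s.nat a i) ≤ S) ∧ ∀ a i, Len S (s.num a i)

theorem size_add_le (a b : ℕ) : Nat.size (a + b) ≤ max (Nat.size a) (Nat.size b) + 1 := by
  rw [Nat.size_le, pow_succ]
  have ha := lt_of_lt_of_le (Nat.lt_size_self a)
    (Nat.pow_le_pow_right two_pos (le_max_left (Nat.size a) (Nat.size b)))
  have hb := lt_of_lt_of_le (Nat.lt_size_self b)
    (Nat.pow_le_pow_right two_pos (le_max_right (Nat.size a) (Nat.size b)))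
  lia

theorem size_mul_le (a b : ℕ) : Nat.size (a * b) ≤ Nat.size a + Nat.size b := by
  rw [Nat.size_le, pow_add]
  exact Nat.mul_lt_mul'' (Nat.lt_size_self a) (Nat.lt_size_self b)

theorem size_le_self (a : ℕ) : Nat.size a ≤ a := by
  rw [Nat.size_le]
  exact Nat.lt_two_pow_self

/-! ### Cost of a run in terms of its number of steps. -/

section Bounds

variable {size : ℝ → ℕ} {d : ℕ} {Len : ℕ → ℝ → Prop} {S : ℕ} {s : State}

theorem NExpr.one_le_width (e : NExpr) : 1 ≤ e.width := by
  cases e <;> simp only [NExpr.width] <;> lia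

theorem RExpr.one_le_width (e : RExpr) : 1 ≤ e.width := by
  cases e <;> simp only [RExpr.width] <;> lia

/-- A product adds the lengths of its factors, so `S` is multiplied by the width. This is good
enough to charge one evaluation, but it would grow exponentially if the values were stored and used
again. -/
theorem NExpr.size_val_le (h : s.Bounded Len S) (e : NExpr) :
    Nat.size (e.val s) ≤ e.width * (S + 1) := by
  induction e with
  | const k => simp only [val, width]; nlinarith [Nat.zero_le (Nat.size k * S)]
  | get a i _ =>
    simp only [val, width]
    nlinarith [h.1 a (i.val s), Nat.zero_le (i.width * (S + 1))]
  | add e f he hf =>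
    simp only [val, width]
    have := size_add_le (e.val s) (f.val s)
    have : max (Nat.size (e.val s)) (Nat.size (f.val s)) ≤ Nat.size (e.val s) + Nat.size (f.val s) :=
      max_le (by lia) (by lia)
    nlinarith
  | sub e f he hf =>
    simp only [val, width]
    have := Nat.size_le_size (Nat.sub_le (e.val s) (f.val s))
    nlinarith
  | mul e f he hf =>
    simp only [val, width]
    have := size_mul_le (e.val s) (f.val s)
    nlinarith

/-- Without products a node adds at most one bit to its longer operand, so `S` enters with
coefficient one. Iterated over the stores of a run, this gives growth linear in the number of steps.
-/
theorem NExpr.Additive.size_val_le (h : s.Bounded Len S) {e : NExpr} (he : e.Additive) :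
    Nat.size (e.val s) ≤ S + e.width := by
  induction e with
  | const k => simp only [val, width]; lia
  | get a i _ =>
    simp only [val, width]
    linarith [h.1 a (i.val s)]
  | add e f he' hf' =>
    simp only [val, width]
    have h1 := size_add_le (e.val s) (f.val s)
    have := he' he.1
    have := hf' he.2
    have : max (Nat.size (e.val s)) (Nat.size (f.val s)) ≤ S + e.width + f.width :=
      max_le (by lia) (by lia)
    lia
  | sub e f he' hf' =>
    simp only [val, width]
    have := Nat.size_le_size (Nat.sub_le (e.val s) (f.val s))
    have := he' he.1
    lia
  | mul e f => exact he.elim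

theorem NExpr.cost_le (h : s.Bounded Len S) {W : ℕ} (e : NExpr) (hW : e.width ≤ W) :
    e.cost s ≤ e.width * (1 + W * (S + 1)) := by
  have key : ∀ e : NExpr, e.width ≤ W → 1 + Nat.size (e.val s) ≤ 1 + W * (S + 1) := fun e he =>
    Nat.add_le_add_left ((e.size_val_le h).trans (Nat.mul_le_mul_right _ he)) 1
  induction e with
  | const k =>
    have := key _ hW
    simp only [val, cost, width] at *
    nlinarith [Nat.zero_le (Nat.size k * (1 + W * (S + 1)))]
  | get a i hi =>
    have := key _ hW
    have := hi (by simp only [width] at hW; lia)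
    simp only [val, cost, width] at *
    nlinarith
  | add e f he hf =>
    have := key _ hW
    have := he (by simp only [width] at hW; lia)
    have := hf (by simp only [width] at hW; lia)
    simp only [val, cost, width] at *
    nlinarith
  | sub e f he hf =>
    have := key _ hW
    have := he (by simp only [width] at hW; lia)
    have := hf (by simp only [width] at hW; lia)
    simp only [val, cost, width] at *
    nlinarith
  | mul e f he hf =>
    have := key _ hW
    have := he (by simp only [width] at hW; lia)
    have := hf (by simp only [width] at hW; lia)
    simp only [val, cost, width] at *
    nlinarith

/-- Bound for the cost of a single operation. -/
def opCost (W d S : ℕ) : ℕ := 1 + W * (S + 1) + d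

theorem opCost_mono {W d S S' : ℕ} (h : S ≤ S') : opCost W d S ≤ opCost W d S' := by
  unfold opCost; gcongr

theorem NExpr.cost_le_opCost (h : s.Bounded Len S) {W : ℕ} (d : ℕ) (e : NExpr)
    (hW : e.width ≤ W) : e.cost s ≤ e.width * opCost W d S :=
  (e.cost_le h hW).trans (Nat.mul_le_mul_left _ (by unfold opCost; lia))

theorem RExpr.len_val (hL : LengthControl size d Len) (h : s.Bounded Len S) (u : RExpr) :
    Len (S + u.width) (u.val s) := by
  induction u with
  | zero => exact hL.zero _
  | get a i => exact hL.mono (by simp only [width]; lia) (h.2 a (i.val s))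
  | add u v hu hv =>
    refine hL.mono (S := S + (u.width + v.width) + 1) (by simp only [width]; lia) ?_
    exact hL.add (hL.mono (by lia) hu) (hL.mono (by lia) hv)
  | sub u v hu hv =>
    refine hL.mono (S := S + (u.width + v.width) + 1) (by simp only [width]; lia) ?_
    exact hL.sub (hL.mono (by lia) hu) (hL.mono (by lia) hv)

theorem RExpr.cost_le (hL : LengthControl size d Len) (h : s.Bounded Len S) {W : ℕ} (u : RExpr)
    (hW : u.width ≤ W) : u.cost size s ≤ u.width * opCost W d S := by
  have key : ∀ u : RExpr, u.width ≤ W → 1 + size (u.val s) ≤ opCost W d S := fun u hu => by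
    have h1 := hL.size_le (u.len_val hL h)
    have h2 := u.one_le_width
    unfold opCost
    nlinarith [Nat.mul_le_mul_right S (h2.trans hu)]
  induction u with
  | zero =>
    have := key _ hW
    simp only [val, cost, width] at *
    lia
  | get a i =>
    have := key _ hW
    have := i.cost_le_opCost h (W := W) d (by simp only [width] at hW; lia)
    simp only [val, cost, width] at *
    nlinarith
  | add u v hu hv =>
    have := key _ hW
    have := hu (by simp only [width] at hW; lia)
    have := hv (by simp only [width] at hW; lia)
    simp only [val, cost, width] at *
    nlinarith
  | sub u v hu hv =>
    have := key _ hW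
    have := hu (by simp only [width] at hW; lia)
    have := hv (by simp only [width] at hW; lia)
    simp only [val, cost, width] at *
    nlinarith

theorem Test.cost_le (hL : LengthControl size d Len) (h : s.Bounded Len S) {W : ℕ} (b : Test)
    (hW : b.width ≤ W) : b.cost size s ≤ b.width * opCost W d S := by
  have h1 : 1 ≤ opCost W d S := by unfold opCost; lia
  induction b with
  | natLe e f =>
    have := e.cost_le_opCost h (W := W) d (by simp only [width] at hW; lia)
    have := f.cost_le_opCost h (W := W) d (by simp only [width] at hW; lia)
    simp only [cost, width] at *
    nlinarith
  | numLe u v =>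
    have := u.cost_le hL h (W := W) (by simp only [width] at hW; lia)
    have := v.cost_le hL h (W := W) (by simp only [width] at hW; lia)
    simp only [cost, width] at *
    nlinarith
  | neg b hb =>
    have := hb (by simp only [width] at hW; lia)
    simp only [cost, width] at *
    nlinarith
  | conj b c hb hc =>
    have := hb (by simp only [width] at hW; lia)
    have := hc (by simp only [width] at hW; lia)
    simp only [cost, width] at *
    nlinarith

theorem State.Bounded.mono (hL : LengthControl size d Len) {S' : ℕ} (hS : S ≤ S')
    (h : s.Bounded Len S) : s.Bounded Len S' :=
  ⟨fun a i => (h.1 a i).trans hS, fun a i => hL.mono hS (h.2 a i)⟩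

theorem State.writeNat_nat (s : State) (a i x b j : ℕ) :
    (s.writeNat a i x).nat b j = if b = a ∧ j = i then x else s.nat b j := by
  by_cases h : b = a
  · subst h
    simp [State.writeNat, Function.update_apply]
  · simp [State.writeNat, h]

theorem State.writeNum_num (s : State) (a i : ℕ) (x : ℝ) (b j : ℕ) :
    (s.writeNum a i x).num b j = if b = a ∧ j = i then x else s.num b j := by
  by_cases h : b = a
  · subst h
    simp [State.writeNum, Function.update_apply]
  · simp [State.writeNum, h]

theorem State.writeNat_num (s : State) (a i x : ℕ) : (s.writeNat a i x).num = s.num := rfl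

theorem State.writeNum_nat (s : State) (a i : ℕ) (x : ℝ) : (s.writeNum a i x).nat = s.nat := rfl

/-- A run with few steps of a program that stores no products has small cost. -/
theorem Run.exists_exec (hL : LengthControl size d Len) {W : ℕ} {A : Prog} {s s' : State} {k : ℕ}
    (hrun : Run A s k s') (hA : A.Additive) (hW : A.width ≤ W) {S : ℕ} (h : s.Bounded Len S) :
    (∃ t, Exec size A s t s' ∧ t ≤ k * (W * opCost W d (S + W * k))) ∧
      s'.Bounded Len (S + W * k) := by
  have one_le : ∀ S, 1 ≤ opCost W d S := fun S => by unfold opCost; lia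
  -- The second half of a sequence or loop starts from cells that have already grown, so `S` must
  -- vary. All steps are then charged at the final bound `S + W * k`, by `opCost_mono`.
  induction hrun generalizing S with
  | skip s =>
    refine ⟨⟨1, .skip s, ?_⟩, h.mono hL (by lia)⟩
    simp only [Prog.width] at hW
    nlinarith [one_le (S + W * 1)]
  | setNat a i e s =>
    simp only [Prog.width] at hW
    refine ⟨⟨_, .setNat a i e s, ?_⟩, ?_, ?_⟩
    · have h1 := i.cost_le_opCost h (W := W) d (by lia)
      have h2 := e.cost_le_opCost h (W := W) d (by lia)
      have h3 := one_le S
      calc _ ≤ (1 + i.width + e.width) * opCost W d S := by nlinarith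
        _ ≤ W * opCost W d (S + W * 1) := Nat.mul_le_mul hW (opCost_mono (by lia))
        _ = _ := by ring
    · intro b j
      have h2 := NExpr.Additive.size_val_le h hA
      have h3 := h.1 b j
      rw [State.writeNat_nat]
      split_ifs <;> lia
    · intro b j
      exact hL.mono (by lia) (h.2 b j)
  | setNum a i u s =>
    simp only [Prog.width] at hW
    refine ⟨⟨_, .setNum a i u s, ?_⟩, ?_, ?_⟩
    · have h1 := i.cost_le_opCost h (W := W) d (by lia)
      have h2 := u.cost_le hL h (W := W) (by lia)
      have h3 := one_le S
      calc _ ≤ (1 + i.width + u.width) * opCost W d S := by nlinarith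
        _ ≤ W * opCost W d (S + W * 1) := Nat.mul_le_mul hW (opCost_mono (by lia))
        _ = _ := by ring
    · intro b j
      exact (h.1 b j).trans (by lia)
    · intro b j
      rw [State.writeNum_num]
      split_ifs
      · exact hL.mono (by lia) (u.len_val hL h)
      · exact hL.mono (by lia) (h.2 b j)
  | @seq A A' s s₁ s₂ k k' _ _ h1 h2 =>
    simp only [Prog.width] at hW
    obtain ⟨⟨t, ht, hle⟩, hb⟩ := h1 hA.1 (by lia) h
    obtain ⟨⟨t', ht', hle'⟩, hb'⟩ := h2 hA.2 (by lia) hb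
    have e : S + W * k + W * k' = S + W * (k + k') := by ring
    rw [e] at hle' hb'
    refine ⟨⟨_, .seq ht ht', ?_⟩, hb'⟩
    have := Nat.mul_le_mul_left k (Nat.mul_le_mul_left W
      (opCost_mono (W := W) (d := d) (show S + W * k ≤ S + W * (k + k') by nlinarith)))
    rw [add_mul]
    lia
  | @iteTrue b A A' s s₁ k hb _ ih =>
    simp only [Prog.width] at hW
    obtain ⟨⟨t, ht, hle⟩, hb'⟩ := ih hA.1 (by lia) h
    refine ⟨⟨_, .iteTrue hb ht, ?_⟩, hb'.mono hL (by nlinarith)⟩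
    have h1 := b.cost_le hL h (W := W) (by lia)
    have h2 : b.width * opCost W d S ≤ W * opCost W d (S + W * (k + 1)) :=
      Nat.mul_le_mul (by lia) (opCost_mono (by lia))
    have h3 := Nat.mul_le_mul_left k (Nat.mul_le_mul_left W
      (opCost_mono (W := W) (d := d) (show S + W * k ≤ S + W * (k + 1) by nlinarith)))
    rw [add_mul]
    lia
  | @iteFalse b A A' s s₁ k hb _ ih =>
    simp only [Prog.width] at hW
    obtain ⟨⟨t, ht, hle⟩, hb'⟩ := ih hA.2 (by lia) h
    refine ⟨⟨_, .iteFalse hb ht, ?_⟩, hb'.mono hL (by nlinarith)⟩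
    have h1 := b.cost_le hL h (W := W) (by lia)
    have h2 : b.width * opCost W d S ≤ W * opCost W d (S + W * (k + 1)) :=
      Nat.mul_le_mul (by lia) (opCost_mono (by lia))
    have h3 := Nat.mul_le_mul_left k (Nat.mul_le_mul_left W
      (opCost_mono (W := W) (d := d) (show S + W * k ≤ S + W * (k + 1) by nlinarith)))
    rw [add_mul]
    lia
  | @loopTrue b A s s₁ s₂ k k' hb _ _ h1 h2 =>
    have hW' := hW
    simp only [Prog.width] at hW
    obtain ⟨⟨t, ht, hle⟩, hb1⟩ := h1 hA (by lia) h
    obtain ⟨⟨t', ht', hle'⟩, hb'⟩ := h2 hA hW' hb1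
    refine ⟨⟨_, .loopTrue hb ht ht', ?_⟩, hb'.mono hL (by nlinarith)⟩
    have h1 := b.cost_le hL h (W := W) (by lia)
    have h2 : b.width * opCost W d S ≤ W * opCost W d (S + W * (1 + k + k')) :=
      Nat.mul_le_mul (by lia) (opCost_mono (by lia))
    have h3 := Nat.mul_le_mul_left k (Nat.mul_le_mul_left W
      (opCost_mono (W := W) (d := d) (show S + W * k ≤ S + W * (1 + k + k') by nlinarith)))
    have h4 := Nat.mul_le_mul_left k' (Nat.mul_le_mul_left W (opCost_mono (W := W) (d := d)
      (show S + W * k + W * k' ≤ S + W * (1 + k + k') by nlinarith)))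
    rw [add_mul, add_mul]
    lia
  | @loopFalse b A s hb =>
    simp only [Prog.width] at hW
    refine ⟨⟨_, .loopFalse hb, ?_⟩, h.mono hL (by lia)⟩
    have h1 := b.cost_le hL h (W := W) (by lia)
    have h2 : b.width * opCost W d S ≤ W * opCost W d (S + W * 1) :=
      Nat.mul_le_mul (by lia) (opCost_mono (by lia))
    lia

end Bounds

/-! ### Frames -/

/-- The natural arrays that a program may change. -/
def Prog.natWrites : Prog → List ℕ
  | .skip => []
  | .setNat a _ _ => [a]
  | .setNum _ _ _ => []
  | .seq A A' => A.natWrites ++ A'.natWrites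
  | .ite _ A A' => A.natWrites ++ A'.natWrites
  | .loop _ A => A.natWrites

/-- The real arrays that a program may change. -/
def Prog.numWrites : Prog → List ℕ
  | .skip => []
  | .setNat _ _ _ => []
  | .setNum a _ _ => [a]
  | .seq A A' => A.numWrites ++ A'.numWrites
  | .ite _ A A' => A.numWrites ++ A'.numWrites
  | .loop _ A => A.numWrites

theorem Run.nat_eq {A : Prog} {s s' : State} {k : ℕ} (h : Run A s k s') {a : ℕ}
    (ha : a ∉ A.natWrites) : s'.nat a = s.nat a := by
  induction h with
  | setNat b i e s =>
    funext j
    rw [State.writeNat_nat, if_neg]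
    rintro ⟨rfl, -⟩
    simp [Prog.natWrites] at ha
  | seq _ _ h1 h2 =>
    simp only [Prog.natWrites, List.mem_append, not_or] at ha
    rw [h2 ha.2, h1 ha.1]
  | iteTrue _ _ h1 =>
    simp only [Prog.natWrites, List.mem_append, not_or] at ha
    exact h1 ha.1
  | iteFalse _ _ h1 =>
    simp only [Prog.natWrites, List.mem_append, not_or] at ha
    exact h1 ha.2
  | loopTrue _ _ _ h1 h2 => rw [h2 ha, h1 ha]
  | _ => rfl

theorem Run.num_eq {A : Prog} {s s' : State} {k : ℕ} (h : Run A s k s') {a : ℕ}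
    (ha : a ∉ A.numWrites) : s'.num a = s.num a := by
  induction h with
  | setNum b i u s =>
    funext j
    rw [State.writeNum_num, if_neg]
    rintro ⟨rfl, -⟩
    simp [Prog.numWrites] at ha
  | seq _ _ h1 h2 =>
    simp only [Prog.numWrites, List.mem_append, not_or] at ha
    rw [h2 ha.2, h1 ha.1]
  | iteTrue _ _ h1 =>
    simp only [Prog.numWrites, List.mem_append, not_or] at ha
    exact h1 ha.1
  | iteFalse _ _ h1 =>
    simp only [Prog.numWrites, List.mem_append, not_or] at ha
    exact h1 ha.2
  | loopTrue _ _ _ h1 h2 => rw [h2 ha, h1 ha]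
  | _ => rfl

/-- `s` agrees with `s₀` outside the natural arrays in `l` and the real arrays in `l'`. -/
def Frame (l l' : List ℕ) (s₀ s : State) : Prop :=
  (∀ a, a ∉ l → s.nat a = s₀.nat a) ∧ ∀ a, a ∉ l' → s.num a = s₀.num a

/-! ### Total correctness with step bounds -/

/-- Started in `s`, the program `A` halts within `N` steps in a state that satisfies `Q`. -/
def Ensures (A : Prog) (N : ℕ) (Q : State → Prop) (s : State) : Prop :=
  ∃ k s', Run A s k s' ∧ k ≤ N ∧ Q s'

namespace Ensures

variable {A A' : Prog} {N N' : ℕ} {Q Q' : State → Prop} {s : State}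

theorem mono (h : Ensures A N Q s) (hN : N ≤ N') (hQ : ∀ s, Q s → Q' s) : Ensures A N' Q' s := by
  obtain ⟨k, s', hr, hk, hs⟩ := h
  exact ⟨k, s', hr, hk.trans hN, hQ _ hs⟩

theorem frame (h : Ensures A N Q s) :
    Ensures A N (fun s' => Frame A.natWrites A.numWrites s s' ∧ Q s') s := by
  obtain ⟨k, s', hr, hk, hs⟩ := h
  exact ⟨k, s', hr, hk, ⟨fun _ => hr.nat_eq, fun _ => hr.num_eq⟩, hs⟩

theorem skip (h : Q s) : Ensures .skip 1 Q s := ⟨_, _, .skip s, le_rfl, h⟩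

theorem setNat {a : ℕ} {i e : NExpr} (h : Q (s.writeNat a (i.val s) (e.val s))) :
    Ensures (.setNat a i e) 1 Q s := ⟨_, _, .setNat a i e s, le_rfl, h⟩

theorem setNum {a : ℕ} {i : NExpr} {u : RExpr} (h : Q (s.writeNum a (i.val s) (u.val s))) :
    Ensures (.setNum a i u) 1 Q s := ⟨_, _, .setNum a i u s, le_rfl, h⟩

theorem seq (h : Ensures A N (Ensures A' N' Q) s) : Ensures (.seq A A') (N + N') Q s := by
  obtain ⟨k, s', hr, hk, k', s'', hr', hk', hs⟩ := h
  exact ⟨_, _, .seq hr hr', by lia, hs⟩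

theorem ite {b : Test} (h : b.Holds s → Ensures A N Q s) (h' : ¬ b.Holds s → Ensures A' N' Q s) :
    Ensures (.ite b A A') (N + N' + 1) Q s := by
  by_cases hb : b.Holds s
  · obtain ⟨k, s', hr, hk, hs⟩ := h hb
    exact ⟨_, _, .iteTrue hb hr, by lia, hs⟩
  · obtain ⟨k, s', hr, hk, hs⟩ := h' hb
    exact ⟨_, _, .iteFalse hb hr, by lia, hs⟩

end Ensures

/-- `for x = 0, …, b - 1 do A`, where `x` names a natural array used as a scalar. -/
def forLoop (x : ℕ) (b : NExpr) (A : Prog) : Prog :=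
  .seq (.setNat x (.const 0) (.const 0))
    (.loop (.neg (.natLe b (.get x (.const 0))))
      (.seq A (.setNat x (.const 0) (.add (.get x (.const 0)) (.const 1)))))

/-- The bound `b` is evaluated again in every round, so `hb` asks for its value in all states that
the loop can reach according to the frame. A round costs the body, the increment and the test, hence
`T + 2`; the initialization and the last test give the other `2`. -/
theorem Ensures.forLoop {x : ℕ} {b : NExpr} {A : Prog} {N T : ℕ} {s₀ : State}
    (I : ℕ → State → Prop) (hx : x ∉ A.natWrites)
    (hI : ∀ j s y, I j s → I j (s.writeNat x 0 y))
    (hb : ∀ s, Frame (x :: A.natWrites) A.numWrites s₀ s → b.val s = N)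
    (h0 : I 0 s₀)
    (hstep : ∀ j s, j < N → Frame (x :: A.natWrites) A.numWrites s₀ s → s.nat x 0 = j →
      I j s → Ensures A T (I (j + 1)) s) :
    Ensures (forLoop x b A) (2 + N * (T + 2)) (I N) s₀ := by
  have hfr : ∀ s y, Frame (x :: A.natWrites) A.numWrites s₀ s →
      Frame (x :: A.natWrites) A.numWrites s₀ (s.writeNat x 0 y) := by
    intro s y h
    refine ⟨fun a ha => ?_, h.2⟩
    rw [← h.1 a ha]
    funext i
    rw [State.writeNat_nat, if_neg]
    rintro ⟨rfl, -⟩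
    simp at ha
  -- Induction on the number `r` of rounds that remain.
  have main : ∀ r j s, j + r = N → Frame (x :: A.natWrites) A.numWrites s₀ s → s.nat x 0 = j →
      I j s → Ensures (.loop (.neg (.natLe b (.get x (.const 0))))
        (.seq A (.setNat x (.const 0) (.add (.get x (.const 0)) (.const 1)))))
        (1 + r * (T + 2)) (I N) s := by
    intro r
    induction r with
    | zero =>
      intro j s hj hF hxj hIj
      refine ⟨1, s, .loopFalse ?_, by lia, by rwa [← show j = N by lia]⟩
      simp only [Test.Holds, NExpr.val, hb s hF, hxj]
      lia
    | succ r ih =>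
      intro j s hj hF hxj hIj
      obtain ⟨k, s₁, hr, hk, hI1⟩ := hstep j s (by lia) hF hxj hIj
      have hx1 : s₁.nat x 0 = j := by rw [hr.nat_eq hx, hxj]
      have hF1 : Frame (x :: A.natWrites) A.numWrites s₀ s₁ :=
        ⟨fun a ha => by
          rw [hr.nat_eq (fun h => ha (List.mem_cons_of_mem _ h)), hF.1 a ha],
          fun a ha => by rw [hr.num_eq ha, hF.2 a ha]⟩
      obtain ⟨k', s₂, hr', hk', hI2⟩ := ih (j + 1) (s₁.writeNat x 0 (j + 1)) (by lia)
        (hfr _ _ hF1) (by simp [State.writeNat_nat]) (hI _ _ _ hI1)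
      have hset := Run.setNat x (.const 0) (.add (.get x (.const 0)) (.const 1)) s₁
      simp only [NExpr.val, hx1] at hset
      refine ⟨_, s₂, .loopTrue ?_ (.seq hr hset) hr', ?_, hI2⟩
      · simp only [Test.Holds, NExpr.val, hb s hF, hxj]
        lia
      · rw [add_mul]
        lia
  refine (Ensures.seq (N := 1) (N' := 1 + N * (T + 2)) (.setNat ?_)).mono (by lia) fun _ h => h
  have hF0 : Frame (x :: A.natWrites) A.numWrites s₀ s₀ := ⟨fun _ _ => rfl, fun _ _ => rfl⟩
  exact main N 0 _ (by lia) (hfr _ _ hF0) (by simp [State.writeNat_nat, NExpr.val]) (hI _ _ _ h0)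

/-! ### The dynamic program -/

/-- `table B w t v i c u` is the largest value of `B + 1 - w(S)` over sets `S` of items below `i`
with `t(S) = c` and `v(S) = u`; it is zero if there is no such set of weight at most `B`. -/
def table (B : ℕ) (w t v : ℕ → ℕ) : ℕ → ℕ → ℕ → ℕ
  | 0, c, u => if c = 0 ∧ u = 0 then B + 1 else 0
  | i + 1, c, u =>
    if t i ≤ c ∧ v i ≤ u then
      max (table B w t v i c u) (table B w t v i (c - t i) (u - v i) - w i)
    else table B w t v i c u

variable {B : ℕ} {w t v : ℕ → ℕ}

/-- The recursion maximizes over leaving out and taking the last item, and `S` follows one of the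
two branches. Subtraction is truncated, so sets heavier than `B` impose nothing. -/
theorem le_table (i : ℕ) : ∀ S ⊆ Finset.range i,
    B + 1 - ∑ j ∈ S, w j ≤ table B w t v i (∑ j ∈ S, t j) (∑ j ∈ S, v j) := by
  induction i with
  | zero =>
    intro S hS
    obtain rfl : S = ∅ := by simpa using hS
    simp [table]
  | succ i ih =>
    intro S hS
    have hsub : S.erase i ⊆ Finset.range i := fun j hj => by
      have h1 := Finset.mem_range.1 (hS (Finset.mem_of_mem_erase hj))
      have h2 := Finset.ne_of_mem_erase hj
      exact Finset.mem_range.2 (by lia)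
    have h := ih _ hsub
    rw [table]
    by_cases hi : i ∈ S
    · have hw := Finset.add_sum_erase S w hi
      have ht := Finset.add_sum_erase S t hi
      have hv := Finset.add_sum_erase S v hi
      rw [if_pos ⟨by lia, by lia⟩]
      refine le_trans ?_ (le_max_right _ _)
      rw [← hw, ← ht, ← hv, Nat.add_sub_cancel_left, Nat.add_sub_cancel_left]
      lia
    · rw [Finset.erase_eq_of_notMem hi] at h
      split_ifs
      · exact h.trans (le_max_left _ _)
      · exact h

/-- A positive entry rules out truncation along the recursion, so the choices made there form a set
of the exact weight. The shift by one in `B + 1` leaves zero free to mean that no packing exists,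
even for packings of weight exactly `B`. -/
theorem exists_of_table_pos (i : ℕ) : ∀ c u, 0 < table B w t v i c u →
    ∃ S ⊆ Finset.range i, ∑ j ∈ S, t j = c ∧ ∑ j ∈ S, v j = u ∧
      table B w t v i c u + ∑ j ∈ S, w j = B + 1 := by
  induction i with
  | zero =>
    intro c u h
    simp only [table] at h ⊢
    split_ifs at h ⊢ with hc
    · exact ⟨∅, by simp, by simp [hc.1], by simp [hc.2], by simp⟩
    · simp at h
  | succ i ih =>
    intro c u h
    have keep : table B w t v (i + 1) c u = table B w t v i c u →
        ∃ S ⊆ Finset.range (i + 1), ∑ j ∈ S, t j = c ∧ ∑ j ∈ S, v j = u ∧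
          table B w t v (i + 1) c u + ∑ j ∈ S, w j = B + 1 := by
      intro e
      rw [e] at h ⊢
      obtain ⟨S, hS, h1⟩ := ih c u h
      exact ⟨S, hS.trans (Finset.range_mono (by lia)), h1⟩
    by_cases hcu : t i ≤ c ∧ v i ≤ u
    · have e : table B w t v (i + 1) c u =
          max (table B w t v i c u) (table B w t v i (c - t i) (u - v i) - w i) := by
        rw [table, if_pos hcu]
      rcases le_total (table B w t v i (c - t i) (u - v i) - w i) (table B w t v i c u) with hle | hle
      · exact keep (by rw [e, max_eq_left hle])
      · rw [max_eq_right hle] at e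
        rw [e] at h ⊢
        obtain ⟨S, hS, h1, h2, h3⟩ := ih (c - t i) (u - v i) (by lia)
        have hi : i ∉ S := fun h => by simpa using hS h
        refine ⟨insert i S, ?_, ?_, ?_, ?_⟩
        · rw [Finset.range_add_one]
          exact Finset.insert_subset_insert _ hS
        all_goals rw [Finset.sum_insert hi]; lia
    · exact keep (by rw [table, if_neg hcu])

/-- The table is stored in a one-dimensional array; this guarantees that different entries occupy
different cells. -/
theorem mixed_radix_inj {R i c u i' c' u' : ℕ} (hc : c < R) (hu : u < R) (hc' : c' < R)
    (hu' : u' < R) (h : (i * R + c) * R + u = (i' * R + c') * R + u') :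
    i = i' ∧ c = c' ∧ u = u' := by
  have key : ∀ {a b a' b' : ℕ}, b < R → b' < R → a * R + b = a' * R + b' → a = a' ∧ b = b' := by
    intro a b a' b' hb hb' e
    have h1 : a = a' := by
      have := congrArg (· / R) e
      simpa [mul_comm _ R, Nat.mul_add_div (show 0 < R by lia), Nat.div_eq_of_lt, hb, hb'] using this
    subst h1
    exact ⟨rfl, by lia⟩
  obtain ⟨h1, h2⟩ := key hu hu' h
  obtain ⟨h3, h4⟩ := key hc hc' h1
  exact ⟨h3, h4, h2⟩

/-! ### Rounded profits -/

/-- The rounded profits `v i` are, up to one unit, the quotients of `M * p i` by the largest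
profit `pm`. -/
structure Rounding (n M : ℕ) (p : ℕ → ℝ) (pm : ℝ) (v : ℕ → ℕ) : Prop where
  le : ∀ i < n, v i ≤ M
  lower : ∀ i < n, (M : ℝ) * p i ≤ v i * pm
  upper : ∀ i < n, (v i : ℝ) * pm ≤ M * p i + pm
  zero : ∀ i < n, pm = 0 → v i = 0

namespace Rounding

variable {n M : ℕ} {p : ℕ → ℝ} {pm : ℝ} {S : Finset ℕ}

theorem sum_lower (h : Rounding n M p pm v) (hS : S ⊆ Finset.range n) :
    (M : ℝ) * ∑ i ∈ S, p i ≤ (∑ i ∈ S, v i : ℕ) * pm := by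
  push_cast
  rw [Finset.mul_sum, Finset.sum_mul]
  exact Finset.sum_le_sum fun i hi => h.lower i (Finset.mem_range.1 (hS hi))

theorem sum_upper (h : Rounding n M p pm v) (hpm : 0 ≤ pm) (hS : S ⊆ Finset.range n) :
    ((∑ i ∈ S, v i : ℕ) : ℝ) * pm ≤ M * ∑ i ∈ S, p i + n * pm := by
  have h1 : ∑ i ∈ S, (v i : ℝ) * pm ≤ ∑ i ∈ S, (M * p i + pm) :=
    Finset.sum_le_sum fun i hi => h.upper i (Finset.mem_range.1 (hS hi))
  have h2 : (S.card : ℝ) ≤ n := by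
    exact_mod_cast (Finset.card_le_card hS).trans_eq (Finset.card_range n)
  rw [Finset.sum_add_distrib, Finset.sum_const, nsmul_eq_mul, ← Finset.mul_sum] at h1
  push_cast
  rw [Finset.sum_mul]
  nlinarith

theorem sum_le (h : Rounding n M p pm v) (hS : S ⊆ Finset.range n) : ∑ i ∈ S, v i ≤ n * M := by
  calc ∑ i ∈ S, v i ≤ ∑ i ∈ Finset.range n, v i := Finset.sum_le_sum_of_subset hS
    _ ≤ ∑ _i ∈ Finset.range n, M := Finset.sum_le_sum fun i hi => h.le i (Finset.mem_range.1 hi)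
    _ = n * M := by simp

/-- Rounding changes the comparison of two sets by at most `n` units. -/
theorem sum_le_sum_add (h : Rounding n M p pm v) (hpm : 0 ≤ pm) {S' : Finset ℕ}
    (hS : S ⊆ Finset.range n) (hS' : S' ⊆ Finset.range n)
    (hp : ∑ i ∈ S, p i ≤ ∑ i ∈ S', p i) : ∑ i ∈ S, v i ≤ ∑ i ∈ S', v i + n := by
  -- For `pm = 0` the inequalities of the rounding carry no information on `v`, and the field `zero`
  -- takes over; otherwise `pm` can be cancelled.
  rcases hpm.eq_or_lt with h0 | h0
  · rw [Finset.sum_eq_zero fun i hi => h.zero i (Finset.mem_range.1 (hS hi)) h0.symm]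
    lia
  · have h1 := h.sum_upper hpm hS
    have h2 := h.sum_lower hS'
    have h3 := mul_le_mul_of_nonneg_left hp (Nat.cast_nonneg (α := ℝ) M)
    have : ((∑ i ∈ S, v i : ℕ) : ℝ) ≤ ((∑ i ∈ S', v i + n : ℕ) : ℝ) := by
      refine le_of_mul_le_mul_right ?_ h0
      push_cast at h1 h2 ⊢
      linarith
    exact_mod_cast this

end Rounding

/-! ### Sets of items as sets of natural numbers, and basic bounds on an instance. -/

theorem sum_map_val_extend {α : Type} [AddCommMonoid α] {n : ℕ} (f : Fin n → α)
    (P : Finset (Fin n)) :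
    ∑ j ∈ P.map Fin.valEmbedding, KnapInstance.extend f j = ∑ i ∈ P, f i := by
  rw [Finset.sum_map]
  exact Finset.sum_congr rfl fun i _ => by simp [KnapInstance.extend]

theorem map_val_subset_range {n : ℕ} (P : Finset (Fin n)) :
    P.map Fin.valEmbedding ⊆ Finset.range n := by
  intro j hj
  obtain ⟨i, -, rfl⟩ := Finset.mem_map.1 hj
  simp

theorem exists_map_val_eq {n : ℕ} {S : Finset ℕ} (hS : S ⊆ Finset.range n) :
    ∃ P : Finset (Fin n), P.map Fin.valEmbedding = S := by
  refine ⟨Finset.univ.filter fun i => (i : ℕ) ∈ S, ?_⟩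
  ext j
  simp only [Finset.mem_map, Finset.mem_filter, Finset.mem_univ, true_and, Fin.valEmbedding_apply]
  constructor
  · rintro ⟨i, hi, rfl⟩
    exact hi
  · intro hj
    exact ⟨⟨j, Finset.mem_range.1 (hS hj)⟩, hj, rfl⟩

namespace KnapInstance

variable (K : KnapInstance)

theorem profit_le_optProfit {P : Finset (Fin K.n)} (hP : K.IsPacking P) :
    K.profit P ≤ K.optProfit :=
  Finset.le_sup' K.profit (by simpa [packings] using hP)

theorem optProfit_nonneg : 0 ≤ K.optProfit := by
  simpa [profit] using K.profit_le_optProfit (P := ∅) (by simp [IsPacking])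

theorem p_le_optProfit (i : Fin K.n) : K.p i ≤ K.optProfit := by
  simpa [profit] using K.profit_le_optProfit (P := {i}) (by simpa [IsPacking] using K.w_le i)

theorem lo_le_hi (i : Fin K.n) : K.lo i ≤ K.hi i := by
  rcases K.interval i with h | h
  · rw [h.1, h.2]
  · exact (h.1.trans h.2).le

/-- One for the nontrivial items, zero for the trivial ones. -/
noncomputable def nontriv (i : ℕ) : ℕ := if extend K.lo i < extend K.hi i then 1 else 0

/-- Since `lo ≤ hi` always holds, an item is nontrivial exactly when `lo < hi`, which the machine
decides by one comparison. -/
theorem card_sdiff_trivialItems (P : Finset (Fin K.n)) :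
    (P \ K.trivialItems).card = ∑ j ∈ P.map Fin.valEmbedding, K.nontriv j := by
  rw [Finset.sum_map, Finset.card_eq_sum_ones, Finset.sdiff_eq_filter, Finset.sum_filter]
  refine Finset.sum_congr rfl fun i _ => ?_
  have h := K.lo_le_hi i
  simp only [trivialItems, Finset.mem_filter, Finset.mem_univ, true_and, nontriv,
    Fin.valEmbedding_apply, extend, Fin.is_lt, dif_pos, Fin.eta]
  by_cases he : K.lo i = K.hi i
  · simp [he]
  · simp [he, lt_of_le_of_ne h he]

theorem sum_nontriv_le {S : Finset ℕ} (hS : S ⊆ Finset.range K.n) :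
    ∑ j ∈ S, K.nontriv j ≤ K.n := by
  calc ∑ j ∈ S, K.nontriv j ≤ ∑ _j ∈ S, 1 :=
        Finset.sum_le_sum fun j _ => by unfold nontriv; split_ifs <;> lia
    _ = S.card := by simp
    _ ≤ K.n := by simpa using Finset.card_le_card hS

end KnapInstance

/-- What the selection in the table achieves. -/
theorem isSmallPacking_of_selection (K : KnapInstance) {m : ℕ} {ε pm : ℝ} (hε : 0 < ε)
    (hm : 2 / ε ≤ m) {v : ℕ → ℕ}
    (hpm : 0 ≤ pm) (hpm' : pm ≤ K.optProfit)
    (hv : Rounding K.n (m * K.n) (KnapInstance.extend K.p) pm v) {c₀ V : ℕ}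
    (hVreach : ∃ c, 0 < table K.B (KnapInstance.extend K.w) K.nontriv v K.n c V)
    (hV : ∀ c < m * K.n * K.n + 1, ∀ u < m * K.n * K.n + 1,
      0 < table K.B (KnapInstance.extend K.w) K.nontriv v K.n c u → u ≤ V)
    (hc : ∀ c < m * K.n * K.n + 1, ∀ u < m * K.n * K.n + 1,
      0 < table K.B (KnapInstance.extend K.w) K.nontriv v K.n c u → V ≤ u + K.n → c₀ ≤ c)
    {P : Finset (Fin K.n)}
    (hPw : ∑ j ∈ P.map Fin.valEmbedding, KnapInstance.extend K.w j ≤ K.B)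
    (hPt : ∑ j ∈ P.map Fin.valEmbedding, K.nontriv j = c₀)
    (hPv : V ≤ ∑ j ∈ P.map Fin.valEmbedding, v j + K.n) : IsSmallPacking ε K P := by
  have hm1 : 1 ≤ m := by
    have : (0 : ℝ) < m := lt_of_lt_of_le (by positivity) hm
    exact_mod_cast this
  have hpack : K.IsPacking P := by
    rwa [sum_map_val_extend] at hPw
  -- The radix is chosen for rounded profits; this makes it large enough for the counts of
  -- nontrivial items too.
  have hR : K.n ≤ m * K.n * K.n := by
    rcases Nat.eq_zero_or_pos K.n with h | h
    · lia
    · calc K.n = 1 * 1 * K.n := by ring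
        _ ≤ m * K.n * K.n := by gcongr; lia
  -- every packing shows up in the table
  have hin : ∀ P : Finset (Fin K.n), K.IsPacking P →
      ∑ j ∈ P.map Fin.valEmbedding, K.nontriv j < m * K.n * K.n + 1 ∧
      ∑ j ∈ P.map Fin.valEmbedding, v j < m * K.n * K.n + 1 ∧
      0 < table K.B (KnapInstance.extend K.w) K.nontriv v K.n
        (∑ j ∈ P.map Fin.valEmbedding, K.nontriv j) (∑ j ∈ P.map Fin.valEmbedding, v j) := by
    intro P hP
    have h1 := K.sum_nontriv_le (map_val_subset_range P)
    have h2 := hv.sum_le (map_val_subset_range P)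
    refine ⟨by lia, by nlinarith, lt_of_lt_of_le ?_ (le_table _ _ (map_val_subset_range P))⟩
    rw [sum_map_val_extend]
    unfold KnapInstance.IsPacking at hP
    lia
  -- the largest rounded profit comes from a packing
  obtain ⟨cV, hcV⟩ := hVreach
  obtain ⟨SV, hSV, -, hSVv, hSVw⟩ := exists_of_table_pos _ _ _ hcV
  obtain ⟨PV, rfl⟩ := exists_map_val_eq hSV
  have hPV : K.IsPacking PV := by
    rw [sum_map_val_extend] at hSVw
    unfold KnapInstance.IsPacking
    lia
  refine ⟨hpack, ?_, ?_⟩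
  · obtain ⟨P', hP', hopt⟩ := K.packings.exists_mem_eq_sup' K.packings_nonempty K.profit
    have hP'pack : K.IsPacking P' := by simpa [KnapInstance.packings] using hP'
    obtain ⟨h1, h2, h3⟩ := hin P' hP'pack
    have hle := hV _ h1 _ h2 h3
    have e1 := hv.sum_lower (map_val_subset_range P')
    have e2 := hv.sum_upper hpm (map_val_subset_range P)
    rw [sum_map_val_extend] at e1 e2
    have e3 : K.profit P' = K.optProfit := hopt.symm
    unfold KnapInstance.profit at e3 ⊢
    rw [e3] at e1
    have e4 : ((∑ j ∈ P'.map Fin.valEmbedding, v j : ℕ) : ℝ) ≤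
        (∑ j ∈ P.map Fin.valEmbedding, v j : ℕ) + K.n := by
      exact_mod_cast hle.trans hPv
    have e5 := mul_le_mul_of_nonneg_right e4 hpm
    -- With `M = m * n`: `M * p* ≤ v(P') * pm ≤ (v(P) + n) * pm ≤ M * p(P) + 2 * n * pm`, and `pm ≤
    -- p*`. One `n` is the slack of the selection, the other the rounding error of `P`.
    have e6 : (m : ℝ) * K.n * K.optProfit ≤ m * K.n * ∑ i ∈ P, K.p i + 2 * K.n * K.optProfit := by
      push_cast at e1 e2 e5
      nlinarith [mul_le_mul_of_nonneg_left hpm' (Nat.cast_nonneg (α := ℝ) K.n)]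
    have h0 := K.optProfit_nonneg
    rcases Nat.eq_zero_or_pos K.n with hn | hn
    · have hz : ∀ P : Finset (Fin K.n), P = ∅ := fun P =>
        Finset.eq_empty_of_forall_notMem fun i => absurd i.2 (by lia)
      rw [hz P', Finset.sum_empty] at e3
      rw [hz P, ← e3]
      simp
    · have hn' : (0 : ℝ) < K.n := by exact_mod_cast hn
      have e7 : (m : ℝ) * K.optProfit ≤ m * ∑ i ∈ P, K.p i + 2 * K.optProfit := by
        refine le_of_mul_le_mul_left ?_ hn'
        nlinarith
      have hm0 : (0 : ℝ) < m := lt_of_lt_of_le (by positivity) hm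
      have e8 : 2 ≤ m * ε := by rwa [div_le_iff₀ hε] at hm
      refine le_of_mul_le_mul_left ?_ hm0
      nlinarith
  -- The optimal packing `P'` inside `Q` and the trivial items meets the threshold: `PV` attains `V`
  -- and has no larger profit, so `V ≤ v(P') + n`. Minimality of `c₀` then compares with `P'`, whose
  -- nontrivial items lie in `Q`.
  · rintro Q ⟨⟨⟨P', hP'pack, hsub, hopt⟩, -⟩, -⟩
    obtain ⟨h1, h2, h3⟩ := hin P' hP'pack
    have hp : ∑ j ∈ PV.map Fin.valEmbedding, KnapInstance.extend K.p j ≤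
        ∑ j ∈ P'.map Fin.valEmbedding, KnapInstance.extend K.p j := by
      rw [sum_map_val_extend, sum_map_val_extend]
      exact (K.profit_le_optProfit hPV).trans hopt.ge
    have h4 := hv.sum_le_sum_add hpm (map_val_subset_range PV) (map_val_subset_range P') hp
    have h5 := hc _ h1 _ h2 h3 (by lia)
    rw [K.card_sdiff_trivialItems, hPt]
    refine h5.trans ?_
    rw [← K.card_sdiff_trivialItems]
    refine Finset.card_le_card fun i hi => ?_
    rw [Finset.mem_sdiff] at hi
    exact (Finset.mem_union.1 (hsub hi.1)).resolve_right hi.2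

/-- The invariant is indexed by the position in lexicographic order; `hrow` identifies the end of a
row with the start of the next. -/
theorem Ensures.forLoop₂ {x y : ℕ} {b b' : NExpr} {A : Prog} {N N' T : ℕ} {s₀ : State}
    (I : ℕ → ℕ → State → Prop) (hx : x ∉ (OfflineKnap.forLoop y b' A).natWrites)
    (hy : y ∉ A.natWrites)
    (hI : ∀ c u s a z, a = x ∨ a = y → I c u s → I c u (s.writeNat a 0 z))
    (hb : ∀ s, Frame (x :: (OfflineKnap.forLoop y b' A).natWrites) A.numWrites s₀ s →
      b.val s = N ∧ b'.val s = N')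
    (h0 : I 0 0 s₀)
    (hstep : ∀ c u s, c < N → u < N' →
      Frame (x :: (OfflineKnap.forLoop y b' A).natWrites) A.numWrites s₀ s →
      s.nat x 0 = c → s.nat y 0 = u → I c u s → Ensures A T (I c (u + 1)) s)
    (hrow : ∀ c s, I c N' s → I (c + 1) 0 s) :
    Ensures (OfflineKnap.forLoop x b (OfflineKnap.forLoop y b' A))
      (2 + N * ((2 + N' * (T + 2)) + 2)) (I N 0) s₀ := by
  have hnum : (OfflineKnap.forLoop y b' A).numWrites = A.numWrites := by
    simp [OfflineKnap.forLoop, Prog.numWrites]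
  have hsub : ∀ a, a ∉ (OfflineKnap.forLoop y b' A).natWrites → a ∉ y :: A.natWrites := by
    intro a ha
    simp only [OfflineKnap.forLoop, Prog.natWrites, List.mem_append, List.mem_cons,
      List.not_mem_nil, or_false, not_or] at ha ⊢
    exact ⟨ha.1, ha.2.1⟩
  refine Ensures.forLoop (fun c => I c 0) hx (fun c s z => hI c 0 s x z (.inl rfl))
    (fun s hs => (hb s (hnum ▸ hs)).1) h0 ?_
  intro c s hc hF hxc hIc
  have hF' : ∀ s', Frame (y :: A.natWrites) A.numWrites s s' →
      Frame (x :: (OfflineKnap.forLoop y b' A).natWrites) A.numWrites s₀ s' := fun s' h' =>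
    ⟨fun a ha => by
      rw [h'.1 a (hsub a fun h => ha (List.mem_cons_of_mem _ h)), hF.1 a ha],
      fun a ha => by rw [h'.2 a ha, hF.2 a (hnum ▸ ha)]⟩
  refine (Ensures.forLoop (I c) hy (fun u s z => hI c u s y z (.inr rfl))
    (fun s' h' => (hb s' (hF' s' h')).2) hIc (T := T) ?_).mono le_rfl (hrow c)
  intro u s' hu hF1 hyu hIu
  exact hstep c u s' hc hu (hF' s' hF1) (by rw [hF1.1 x (hsub x hx), hxc]) hyu hIu

/-! ### The program -/

/-- Cell zero of a natural array. -/
def nvar (a : ℕ) : NExpr := .get a (.const 0)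

/-- Cell zero of a real array. -/
def rvar (a : ℕ) : RExpr := .get a (.const 0)

/-- Computes the largest profit in real array `3`. -/
def maxLoop : Prog :=
  forLoop 10 (nvar 0)
    (.ite (.numLe (.get 0 (nvar 10)) (rvar 3)) .skip (.setNum 3 (.const 0) (.get 0 (nvar 10))))

theorem maxLoop_ensures (s₀ : State) (h3 : s₀.num 3 0 = 0) :
    Ensures maxLoop (2 + s₀.nat 0 0 * (3 + 2)) (fun s =>
      (∀ i < s₀.nat 0 0, s₀.num 0 i ≤ s.num 3 0) ∧
        (s.num 3 0 = 0 ∨ ∃ i < s₀.nat 0 0, s.num 3 0 = s₀.num 0 i)) s₀ := by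
  refine Ensures.forLoop (fun j s => (∀ i < j, s₀.num 0 i ≤ s.num 3 0) ∧
      (s.num 3 0 = 0 ∨ ∃ i < s₀.nat 0 0, s.num 3 0 = s₀.num 0 i)) ?_ ?_ ?_ ?_ ?_
  · simp [Prog.natWrites]
  · intro j s y h
    simpa [State.writeNat_num] using h
  · intro s hF
    simp [nvar, NExpr.val, hF.1 0 (by simp [Prog.natWrites])]
  · simp [h3]
  · rintro j s hj hF hx ⟨h1, h2⟩
    have e0 := hF.2 0 (by simp [Prog.numWrites])
    refine Ensures.ite (fun hb => Ensures.skip ?_) (fun hb => Ensures.setNum ?_)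
    · simp only [Test.Holds, RExpr.val, NExpr.val, nvar, rvar, hx, e0] at hb
      refine ⟨fun i hi => ?_, h2⟩
      rcases Nat.lt_succ_iff_lt_or_eq.1 hi with h | rfl
      · exact h1 i h
      · exact hb
    · simp only [Test.Holds, RExpr.val, NExpr.val, nvar, rvar, hx, e0, not_le] at hb
      simp only [State.writeNum_num, RExpr.val, NExpr.val, nvar, hx, e0, and_self, if_true]
      refine ⟨fun i hi => ?_, .inr ⟨j, hj, rfl⟩⟩
      rcases Nat.lt_succ_iff_lt_or_eq.1 hi with h | rfl
      · exact (h1 i h).trans hb.le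
      · exact le_rfl

/-- The rounding factor. -/
def factor (m : ℕ) : NExpr := .mul (.const m) (nvar 0)

/-- Computes a multiple of the profit of the current item in real array `4`. -/
def scaleLoop (m : ℕ) : Prog :=
  forLoop 11 (factor m) (.setNum 4 (.const 0) (.add (rvar 4) (.get 0 (nvar 10))))

/-- Repeated addition replaces the product, at the price of `m * n` rounds. -/
theorem scaleLoop_ensures (m : ℕ) (s₀ : State) (h4 : s₀.num 4 0 = 0) :
    Ensures (scaleLoop m) (2 + m * s₀.nat 0 0 * (1 + 2)) (fun s =>
      s.num 4 0 = (m * s₀.nat 0 0 : ℕ) * s₀.num 0 (s₀.nat 10 0)) s₀ := by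
  refine Ensures.forLoop (fun j s => s.num 4 0 = j * s₀.num 0 (s₀.nat 10 0)) ?_ ?_ ?_ ?_ ?_
  · simp [Prog.natWrites]
  · intro j s y h
    simpa [State.writeNat_num] using h
  · intro s hF
    simp [factor, nvar, NExpr.val, hF.1 0 (by simp [Prog.natWrites])]
  · simp [h4]
  · intro j s hj hF hx h
    refine Ensures.setNum ?_
    simp only [State.writeNum_num, RExpr.val, NExpr.val, nvar, rvar, and_self, if_true, h,
      hF.2 0 (by simp [Prog.numWrites]), hF.1 10 (by simp [Prog.natWrites])]
    push_cast
    ring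

/-- Counts the multiples of the largest profit that lie below real cell `4`. -/
def countLoop (m : ℕ) : Prog :=
  forLoop 11 (factor m)
    (.seq (.ite (.numLe (rvar 4) (rvar 5)) .skip
      (.setNat 4 (nvar 10) (.add (.get 4 (nvar 10)) (.const 1))))
      (.setNum 5 (.const 0) (.add (rvar 5) (rvar 3))))

/-- Let `x` be real cell `4` and `pm` real cell `3`. The indices `j` with `j * pm < x` form an
initial segment, and their number is `x / pm` rounded up when `pm > 0`. Accordingly the count equals
`j` until some multiple reaches `x`, and stays fixed afterwards; `hle` ensures that `m * n` rounds
suffice. -/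
theorem countLoop_ensures (m : ℕ) (s₀ : State) (h3 : 0 ≤ s₀.num 3 0) (h4 : 0 ≤ s₀.num 4 0)
    (h5 : s₀.num 5 0 = 0)
    (hv : s₀.nat 4 (s₀.nat 10 0) = 0)
    (hle : s₀.num 4 0 ≤ (m * s₀.nat 0 0 : ℕ) * s₀.num 3 0) :
    Ensures (countLoop m) (2 + m * s₀.nat 0 0 * (4 + 2)) (fun s =>
      (∀ i, i ≠ s₀.nat 10 0 → s.nat 4 i = s₀.nat 4 i) ∧
      s.nat 4 (s₀.nat 10 0) ≤ m * s₀.nat 0 0 ∧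
      s₀.num 4 0 ≤ s.nat 4 (s₀.nat 10 0) * s₀.num 3 0 ∧
      s.nat 4 (s₀.nat 10 0) * s₀.num 3 0 ≤ s₀.num 4 0 + s₀.num 3 0 ∧
      (s₀.num 3 0 = 0 → s.nat 4 (s₀.nat 10 0) = 0)) s₀ := by
  refine (Ensures.forLoop (N := m * s₀.nat 0 0) (T := 4) (fun j s =>
      s.num 5 0 = j * s₀.num 3 0 ∧
      (∀ i, i ≠ s₀.nat 10 0 → s.nat 4 i = s₀.nat 4 i) ∧
      s.nat 4 (s₀.nat 10 0) ≤ j ∧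
      (s₀.num 4 0 ≤ s.nat 4 (s₀.nat 10 0) * s₀.num 3 0 ∨ s.nat 4 (s₀.nat 10 0) = j) ∧
      s.nat 4 (s₀.nat 10 0) * s₀.num 3 0 ≤ s₀.num 4 0 + s₀.num 3 0 ∧
      (s₀.num 3 0 = 0 → s.nat 4 (s₀.nat 10 0) = 0)) ?_ ?_ ?_ ?_ ?_).mono le_rfl ?_
  · simp [Prog.natWrites]
  · intro j s y h
    simpa [State.writeNat_num, State.writeNat_nat] using h
  · intro s hF
    simp [factor, nvar, NExpr.val, hF.1 0 (by simp [Prog.natWrites])]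
  · simp [h5, hv]
    positivity
  · rintro j s hj hF hx ⟨i1, i2, i3, i4, i5, i6⟩
    have e4 := hF.2 4 (by simp [Prog.numWrites])
    have e3 := hF.2 3 (by simp [Prog.numWrites])
    have e10 := hF.1 10 (by simp [Prog.natWrites])
    refine Ensures.seq (N := 3) (N' := 1) (Ensures.ite (N := 1) (N' := 1)
      (fun hb => Ensures.skip (Ensures.setNum ?_))
      (fun hb => Ensures.setNat (Ensures.setNum ?_)))
    · simp only [Test.Holds, RExpr.val, NExpr.val, rvar, i1, e4] at hb
      simp only [State.writeNum_num, State.writeNum_nat, RExpr.val, NExpr.val, rvar, and_self,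
        if_true, i1, e3]
      refine ⟨by push_cast; ring, i2, by lia, .inl ?_, i5, i6⟩
      rcases i4 with h | h
      · exact h
      · rwa [h]
    · simp only [Test.Holds, RExpr.val, NExpr.val, rvar, i1, e4, not_le] at hb
      have hvj : s.nat 4 (s₀.nat 10 0) = j := by
        rcases i4 with h | h
        · by_contra hne
          have : (s.nat 4 (s₀.nat 10 0) : ℝ) ≤ j := by exact_mod_cast i3
          nlinarith [mul_le_mul_of_nonneg_right this h3]
        · exact h
      simp only [State.writeNum_num, State.writeNum_nat, State.writeNat_nat, State.writeNat_num,
        RExpr.val, NExpr.val, nvar, rvar, and_self, if_true, i1, e3, e10, true_and, hvj]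
      refine ⟨by push_cast; ring, fun i hi => by rw [if_neg hi, i2 i hi], le_rfl, .inr trivial, ?_, ?_⟩
      · push_cast
        linarith
      -- For `pm = 0`, `hle` gives `x ≤ 0`, so the count is never raised.
      · intro h0
        rw [h0] at hb i5 hle
        simp at hb hle
        linarith
  · rintro s ⟨i1, i2, i3, i4, i5, i6⟩
    refine ⟨i2, i3, ?_, i5, i6⟩
    rcases i4 with h | h
    · exact h
    · rwa [h]

/-- Marks the nontrivial items in natural array `5`, and rounds the profits to natural
array `4`. -/
def roundBody (m : ℕ) : Prog :=
  .seq (.ite (.numLe (.get 2 (nvar 10)) (.get 1 (nvar 10))) .skip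
      (.setNat 5 (nvar 10) (.const 1)))
    (.seq (.setNum 4 (.const 0) .zero) (.seq (scaleLoop m)
      (.seq (.setNum 5 (.const 0) .zero) (countLoop m))))

theorem roundBody_ensures (m : ℕ) (s₀ : State) (hp : 0 ≤ s₀.num 0 (s₀.nat 10 0))
    (hle : s₀.num 0 (s₀.nat 10 0) ≤ s₀.num 3 0) (hv : s₀.nat 4 (s₀.nat 10 0) = 0)
    (ht : s₀.nat 5 (s₀.nat 10 0) = 0) :
    Ensures (roundBody m)
      (3 + (1 + ((2 + m * s₀.nat 0 0 * (1 + 2)) + (1 + (2 + m * s₀.nat 0 0 * (4 + 2))))))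
      (fun s =>
        (∀ i, i ≠ s₀.nat 10 0 → s.nat 4 i = s₀.nat 4 i) ∧
        (∀ i, i ≠ s₀.nat 10 0 → s.nat 5 i = s₀.nat 5 i) ∧
        s.nat 5 (s₀.nat 10 0) =
          (if s₀.num 1 (s₀.nat 10 0) < s₀.num 2 (s₀.nat 10 0) then 1 else 0) ∧
        s.nat 4 (s₀.nat 10 0) ≤ m * s₀.nat 0 0 ∧
        (m * s₀.nat 0 0 : ℕ) * s₀.num 0 (s₀.nat 10 0) ≤ s.nat 4 (s₀.nat 10 0) * s₀.num 3 0 ∧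
        s.nat 4 (s₀.nat 10 0) * s₀.num 3 0 ≤
          (m * s₀.nat 0 0 : ℕ) * s₀.num 0 (s₀.nat 10 0) + s₀.num 3 0 ∧
        (s₀.num 3 0 = 0 → s.nat 4 (s₀.nat 10 0) = 0)) s₀ := by
  have hmark : Ensures (.ite (.numLe (.get 2 (nvar 10)) (.get 1 (nvar 10))) .skip
      (.setNat 5 (nvar 10) (.const 1))) 3 (fun s =>
        (∀ i, i ≠ s₀.nat 10 0 → s.nat 5 i = s₀.nat 5 i) ∧
        s.nat 5 (s₀.nat 10 0) =
          (if s₀.num 1 (s₀.nat 10 0) < s₀.num 2 (s₀.nat 10 0) then 1 else 0)) s₀ := by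
    refine Ensures.ite (N := 1) (N' := 1) (fun hb => Ensures.skip ?_) (fun hb => Ensures.setNat ?_)
    · simp only [Test.Holds, RExpr.val, NExpr.val, nvar] at hb
      simp [hb, ht]
    · simp only [Test.Holds, RExpr.val, NExpr.val, nvar, not_le] at hb
      simp only [NExpr.val, nvar, State.writeNat_nat]
      simp +contextual [hb]
  refine Ensures.seq (hmark.frame.mono le_rfl ?_)
  rintro s₁ ⟨hF₁, h5, h5'⟩
  have f0 := hF₁.1 0 (by simp [Prog.natWrites])
  have f4 := hF₁.1 4 (by simp [Prog.natWrites])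
  have f10 := hF₁.1 10 (by simp [Prog.natWrites])
  have g0 := hF₁.2 0 (by simp [Prog.numWrites])
  have g3 := hF₁.2 3 (by simp [Prog.numWrites])
  refine Ensures.seq (Ensures.setNum (Ensures.seq ?_))
  have hs := scaleLoop_ensures m (s₁.writeNum 4 0 0) (by simp [State.writeNum_num])
  simp only [State.writeNum_nat, State.writeNum_num, f0, f10, g0] at hs
  refine hs.frame.mono le_rfl ?_
  rintro s₂ ⟨hF₂, h4⟩
  have d0 := hF₂.1 0 (by simp [scaleLoop, forLoop, Prog.natWrites])
  have d4 := hF₂.1 4 (by simp [scaleLoop, forLoop, Prog.natWrites])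
  have d5 := hF₂.1 5 (by simp [scaleLoop, forLoop, Prog.natWrites])
  have d10 := hF₂.1 10 (by simp [scaleLoop, forLoop, Prog.natWrites])
  have d3 := congrFun (hF₂.2 3 (by simp [scaleLoop, forLoop, Prog.numWrites])) 0
  simp only [State.writeNum_nat] at d0 d4 d5 d10
  simp [State.writeNum_num] at d3
  rw [f0] at d0
  rw [f4] at d4
  rw [f10] at d10
  rw [g3] at d3
  simp at h4
  refine Ensures.seq (Ensures.setNum ?_)
  have hc := countLoop_ensures m (s₂.writeNum 5 0 0)
    (by simpa [State.writeNum_num, d3] using hp.trans hle)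
    (by simp [State.writeNum_num, h4]; positivity) (by simp [State.writeNum_num])
    (by simpa [State.writeNum_nat, d10, d4] using hv)
    (by
      simp [State.writeNum_num, State.writeNum_nat, h4, d3, d0]
      exact mul_le_mul_of_nonneg_left hle (by positivity))
  simp [State.writeNum_num, State.writeNum_nat, h4, d3, d0, d10, d4] at hc
  refine hc.frame.mono le_rfl ?_
  rintro s₃ ⟨hF₃, c1, c2, c3, c4, c5⟩
  have b5 := hF₃.1 5 (by simp [countLoop, forLoop, Prog.natWrites])
  rw [State.writeNum_nat, d5] at b5
  rw [b5]
  push_cast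
  exact ⟨c1, h5, h5', c2, c3, c4, c5⟩

/-- Rounds all profits. -/
def roundLoop (m : ℕ) : Prog := forLoop 10 (nvar 0) (roundBody m)

theorem roundLoop_ensures (m : ℕ) (s₀ : State) (hp : ∀ i < s₀.nat 0 0, 0 ≤ s₀.num 0 i)
    (hle : ∀ i < s₀.nat 0 0, s₀.num 0 i ≤ s₀.num 3 0) (hv : ∀ i, s₀.nat 4 i = 0)
    (ht : ∀ i, s₀.nat 5 i = 0) :
    Ensures (roundLoop m)
      (2 + s₀.nat 0 0 * (3 + (1 + ((2 + m * s₀.nat 0 0 * (1 + 2)) +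
        (1 + (2 + m * s₀.nat 0 0 * (4 + 2))))) + 2))
      (fun s =>
        (∀ i < s₀.nat 0 0, s.nat 5 i = if s₀.num 1 i < s₀.num 2 i then 1 else 0) ∧
        (∀ i, s₀.nat 0 0 ≤ i → s.nat 5 i = 0) ∧
        Rounding (s₀.nat 0 0) (m * s₀.nat 0 0) (s₀.num 0) (s₀.num 3 0) (s.nat 4)) s₀ := by
  refine (Ensures.forLoop (N := s₀.nat 0 0) (fun j s =>
      (∀ i < j, s.nat 5 i = if s₀.num 1 i < s₀.num 2 i then 1 else 0) ∧
      (∀ i, j ≤ i → s.nat 5 i = 0 ∧ s.nat 4 i = 0) ∧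
      Rounding j (m * s₀.nat 0 0) (s₀.num 0) (s₀.num 3 0) (s.nat 4)) ?_ ?_ ?_ ?_ ?_).mono le_rfl ?_
  · simp [roundBody, countLoop, scaleLoop, forLoop, Prog.natWrites]
  · rintro j s y ⟨h1, h2, h3⟩
    have e : ∀ a, a ≠ 10 → (s.writeNat 10 0 y).nat a = s.nat a := fun a ha => by
      funext i
      simp [State.writeNat_nat, ha]
    rw [e 5 (by lia), e 4 (by lia)]
    exact ⟨h1, h2, h3⟩
  · intro s hF
    simp [nvar, NExpr.val,
      hF.1 0 (by simp [roundBody, countLoop, scaleLoop, forLoop, Prog.natWrites])]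
  · refine ⟨by simp, fun i _ => ⟨ht i, hv i⟩, ?_⟩
    constructor <;> simp
  · rintro j s hj hF hx ⟨h1, h2, h3⟩
    have f0 := hF.1 0 (by simp [roundBody, countLoop, scaleLoop, forLoop, Prog.natWrites])
    have g0 := hF.2 0 (by simp [roundBody, countLoop, scaleLoop, forLoop, Prog.numWrites])
    have g1 := hF.2 1 (by simp [roundBody, countLoop, scaleLoop, forLoop, Prog.numWrites])
    have g2 := hF.2 2 (by simp [roundBody, countLoop, scaleLoop, forLoop, Prog.numWrites])
    have g3 := hF.2 3 (by simp [roundBody, countLoop, scaleLoop, forLoop, Prog.numWrites])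
    have hbody := roundBody_ensures m s (by rw [g0, hx]; exact hp j hj)
      (by rw [g0, g3, hx]; exact hle j hj) (by rw [hx]; exact (h2 j le_rfl).2)
      (by rw [hx]; exact (h2 j le_rfl).1)
    rw [hx, f0, g0, g1, g2, g3] at hbody
    refine hbody.mono le_rfl ?_
    rintro s' ⟨c1, c2, c3, c4, c5, c6, c7⟩
    have hlt : ∀ i, i < j + 1 → i ≠ j → i < j := fun i h h' => by lia
    refine ⟨fun i hi => ?_, fun i hi => ?_, ?_, ?_, ?_, ?_⟩
    · by_cases e : i = j
      · rw [e, c3]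
      · rw [c2 i e, h1 i (hlt i hi e)]
    · rw [c1 i (by lia), c2 i (by lia)]
      exact h2 i (by lia)
    all_goals
      intro i hi
      by_cases e : i = j
      · subst e
        assumption
      · rw [c1 i e]
        first
        | exact h3.le i (hlt i hi e)
        | exact h3.lower i (hlt i hi e)
        | exact h3.upper i (hlt i hi e)
        | exact h3.zero i (hlt i hi e)
  · rintro s ⟨h1, h2, h3⟩
    exact ⟨h1, fun i hi => (h2 i hi).1, h3⟩

/-- The number of values of each coordinate of the table. -/
def radix (m : ℕ) : NExpr := .add (.mul (.mul (.const m) (nvar 0)) (nvar 0)) (.const 1)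

/-- The index of a table entry. -/
def index (m : ℕ) (i c u : NExpr) : NExpr :=
  .add (.mul (.add (.mul i (radix m)) c) (radix m)) u

/-- The table entry without the current item. -/
def entrySkip (m : ℕ) : NExpr := .get 6 (index m (nvar 10) (nvar 11) (nvar 12))

/-- The table entry with the current item. -/
def entryTake (m : ℕ) : NExpr :=
  .sub (.get 6 (index m (nvar 10) (.sub (nvar 11) (.get 5 (nvar 10)))
    (.sub (nvar 12) (.get 4 (nvar 10))))) (.get 2 (nvar 10))

/-- Computes one table entry. -/
def fillBody (m : ℕ) : Prog :=
  .ite (.conj (.conj (.natLe (.get 5 (nvar 10)) (nvar 11)) (.natLe (.get 4 (nvar 10)) (nvar 12)))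
      (.natLe (entrySkip m) (entryTake m)))
    (.setNat 6 (index m (.add (nvar 10) (.const 1)) (nvar 11) (nvar 12)) (entryTake m))
    (.setNat 6 (index m (.add (nvar 10) (.const 1)) (nvar 11) (nvar 12)) (entrySkip m))

/-- Computes one layer of the table. -/
def fillLayer (m : ℕ) : Prog := forLoop 11 (radix m) (forLoop 12 (radix m) (fillBody m))

/-- Computes the table in natural array `6`. -/
def fillLoop (m : ℕ) : Prog :=
  .seq (.setNat 6 (.const 0) (.add (nvar 1) (.const 1))) (forLoop 10 (nvar 0) (fillLayer m))

/-- The dynamic program for the data in the memory. -/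
def State.table (s : State) : ℕ → ℕ → ℕ → ℕ :=
  OfflineKnap.table (s.nat 1 0) (s.nat 2) (s.nat 5) (s.nat 4)

/-- The value of `radix m`. -/
def State.radix (m : ℕ) (s : State) : ℕ := m * s.nat 0 0 * s.nat 0 0 + 1

/-- Natural array `6` holds the entries of the table for the data in `s₀` that satisfy `D`. -/
def TableOn (m : ℕ) (s₀ : State) (D : ℕ → ℕ → ℕ → Prop) (s : State) : Prop :=
  ∀ i c u, c < s₀.radix m → u < s₀.radix m → D i c u →
    s.nat 6 ((i * s₀.radix m + c) * s₀.radix m + u) = s₀.table i c u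

theorem TableOn.writeNat {m : ℕ} {s₀ s : State} {D : ℕ → ℕ → ℕ → Prop} (h : TableOn m s₀ D s)
    {a : ℕ} (ha : a ≠ 6) (i y : ℕ) : TableOn m s₀ D (s.writeNat a i y) := by
  intro i c u hc hu hD
  rw [State.writeNat_nat, if_neg (fun h => ha h.1.symm)]
  exact h i c u hc hu hD

theorem fillLayer_ensures (m : ℕ) (s₀ s₁ : State) (h : TableOn m s₀ (fun i _ _ => i ≤ s₁.nat 10 0) s₁)
    (h0 : s₁.nat 0 = s₀.nat 0) (h2 : s₁.nat 2 = s₀.nat 2) (h4 : s₁.nat 4 = s₀.nat 4)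
    (h5 : s₁.nat 5 = s₀.nat 5) :
    Ensures (fillLayer m) (2 + s₀.radix m * ((2 + s₀.radix m * (3 + 2)) + 2))
      (TableOn m s₀ (fun i _ _ => i ≤ s₁.nat 10 0 + 1)) s₁ := by
  refine (Ensures.forLoop₂ (N := s₀.radix m) (N' := s₀.radix m) (T := 3)
    (fun c u => TableOn m s₀ (fun i c' u' => i ≤ s₁.nat 10 0 ∨
      (i = s₁.nat 10 0 + 1 ∧ (c' < c ∨ (c' = c ∧ u' < u))))) ?_ ?_ ?_ ?_ ?_ ?_ ?_).mono le_rfl ?_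
  · simp [fillBody, forLoop, Prog.natWrites]
  · simp [fillBody, Prog.natWrites]
  · rintro c u s a z ha h
    exact h.writeNat (by lia) _ _
  · intro s hF
    simp [radix, NExpr.val, nvar, State.radix, ← h0,
      hF.1 0 (by simp [fillBody, forLoop, Prog.natWrites])]
  · intro i c u hc hu hD
    exact h i c u hc hu (by lia)
  · intro c u s hc hu hF hxc hyu hI
    have e0 := hF.1 0 (by simp [fillBody, forLoop, Prog.natWrites])
    have e2 := hF.1 2 (by simp [fillBody, forLoop, Prog.natWrites])
    have e4 := hF.1 4 (by simp [fillBody, forLoop, Prog.natWrites])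
    have e5 := hF.1 5 (by simp [fillBody, forLoop, Prog.natWrites])
    have e10 := hF.1 10 (by simp [fillBody, forLoop, Prog.natWrites])
    rw [h0] at e0
    rw [h2] at e2
    rw [h4] at e4
    rw [h5] at e5
    have hR : (radix m).val s = s₀.radix m := by simp [radix, NExpr.val, nvar, State.radix, e0]
    have hskip : (entrySkip m).val s = s₀.table (s₁.nat 10 0) c u := by
      simp only [entrySkip, index, NExpr.val, hR, nvar, e10, hxc, hyu]
      exact hI _ _ _ hc hu (.inl le_rfl)
    -- Truncated differences stay below the radix, so the cell that is read belongs to the previous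
    -- layer even when the item does not fit the pair.
    have htake : (entryTake m).val s = s₀.table (s₁.nat 10 0) (c - s₀.nat 5 (s₁.nat 10 0))
        (u - s₀.nat 4 (s₁.nat 10 0)) - s₀.nat 2 (s₁.nat 10 0) := by
      simp only [entryTake, index, NExpr.val, hR, nvar, e10, hxc, hyu, e5, e4, e2]
      rw [hI _ _ _ (by lia) (by lia) (.inl le_rfl)]
    have hidx : (index m (.add (nvar 10) (.const 1)) (nvar 11) (nvar 12)).val s =
        ((s₁.nat 10 0 + 1) * s₀.radix m + c) * s₀.radix m + u := by
      simp only [index, NExpr.val, hR, nvar, e10, hxc, hyu]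
    -- By `mixed_radix_inj` the write leaves all entries computed earlier intact.
    have hwrite : ∀ x, x = s₀.table (s₁.nat 10 0 + 1) c u →
        TableOn m s₀ (fun i c' u' => i ≤ s₁.nat 10 0 ∨
          (i = s₁.nat 10 0 + 1 ∧ (c' < c ∨ (c' = c ∧ u' < u + 1))))
          (s.writeNat 6 (((s₁.nat 10 0 + 1) * s₀.radix m + c) * s₀.radix m + u) x) := by
      intro x hx i c' u' hc' hu' hD
      rw [State.writeNat_nat]
      split_ifs with he
      · obtain ⟨rfl, rfl, rfl⟩ := mixed_radix_inj hc' hu' hc hu he.2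
        exact hx
      · refine hI i c' u' hc' hu' ?_
        rcases hD with h | ⟨rfl, h | ⟨rfl, h⟩⟩
        · exact .inl h
        · exact .inr ⟨rfl, .inl h⟩
        · refine .inr ⟨rfl, .inr ⟨rfl, ?_⟩⟩
          rcases Nat.lt_succ_iff_lt_or_eq.1 h with h | rfl
          · exact h
          · exact absurd ⟨rfl, rfl⟩ he
    refine Ensures.ite (N := 1) (N' := 1) (fun hb => Ensures.setNat ?_)
      (fun hb => Ensures.setNat ?_)
    all_goals
      simp only [Test.Holds, hskip, htake] at hb
      simp only [NExpr.val, nvar, e10, hxc, hyu, e5, e4] at hb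
      rw [hidx]
      refine hwrite _ ?_
      simp only [hskip, htake]
      unfold State.table at hb ⊢
      rw [OfflineKnap.table]
    · rw [if_pos hb.1, max_eq_right hb.2]
    · split_ifs with hif
      · rw [max_eq_left]
        by_contra hlt
        exact hb ⟨hif, (not_le.1 hlt).le⟩
      · rfl
  · intro c s h i c' u' hc' hu' hD
    exact h i c' u' hc' hu' (by lia)
  · intro s h i c' u' hc' hu' hD
    exact h i c' u' hc' hu' (by lia)

theorem fillLoop_ensures (m : ℕ) (s₀ : State) (h6 : ∀ i, s₀.nat 6 i = 0) :
    Ensures (fillLoop m)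
      (1 + (2 + s₀.nat 0 0 * (2 + s₀.radix m * ((2 + s₀.radix m * (3 + 2)) + 2) + 2)))
      (TableOn m s₀ (fun i _ _ => i ≤ s₀.nat 0 0)) s₀ := by
  refine Ensures.seq (Ensures.setNat ?_)
  simp only [NExpr.val, nvar]
  refine (Ensures.forLoop (N := s₀.nat 0 0) (fun j => TableOn m s₀ (fun i _ _ => i ≤ j))
    ?_ ?_ ?_ ?_ ?_)
  · simp [fillLayer, fillBody, forLoop, Prog.natWrites]
  · rintro j s y h
    exact h.writeNat (by lia) _ _
  · intro s hF
    have := hF.1 0 (by simp [fillLayer, fillBody, forLoop, Prog.natWrites])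
    simp [NExpr.val, this, State.writeNat_nat]
  · intro i c u hc hu hi
    -- Layer zero has one nonzero entry, stored in cell zero; the others are correct because array
    -- `6` is initially zero.
    obtain rfl : i = 0 := by lia
    simp only [State.writeNat_nat, true_and, h6, State.table, OfflineKnap.table]
    refine if_congr ?_ rfl rfl
    constructor
    · intro h
      obtain ⟨-, h1, h2⟩ := mixed_radix_inj (i := 0) (i' := 0) (c' := 0) (u' := 0) hc hu
        (by lia) (by lia) (by simpa using h)
      exact ⟨h1, h2⟩
    · rintro ⟨rfl, rfl⟩
      simp
  · intro j s hj hF hx h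
    have e : ∀ a, a ≠ 6 → (s₀.writeNat 6 0 (s₀.nat 1 0 + 1)).nat a = s₀.nat a := fun a ha => by
      funext i
      simp [State.writeNat_nat, ha]
    have := fillLayer_ensures m s₀ s (by rwa [hx])
      (by rw [hF.1 0 (by simp [fillLayer, fillBody, forLoop, Prog.natWrites]), e 0 (by lia)])
      (by rw [hF.1 2 (by simp [fillLayer, fillBody, forLoop, Prog.natWrites]), e 2 (by lia)])
      (by rw [hF.1 4 (by simp [fillLayer, fillBody, forLoop, Prog.natWrites]), e 4 (by lia)])
      (by rw [hF.1 5 (by simp [fillLayer, fillBody, forLoop, Prog.natWrites]), e 5 (by lia)])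
    rwa [hx] at this

/-! ### Selection of a table entry -/

/-- The final table entry of the current pair. -/
def entryFinal (m : ℕ) : NExpr := .get 6 (index m (nvar 0) (nvar 11) (nvar 12))

/-- Scans the final layer of the table, and keeps the last pair that passes the test. -/
def scan (m : ℕ) (b : Test) : Prog :=
  forLoop 11 (radix m) (forLoop 12 (radix m)
    (.ite (.conj (.natLe (.const 1) (entryFinal m)) b)
      (.seq (.setNat 13 (.const 0) (nvar 11)) (.setNat 14 (.const 0) (nvar 12))) .skip))

/-- Natural array `6` holds the final layer of the table `F`. -/
def FinalLayer (m : ℕ) (F : ℕ → ℕ → ℕ) (s : State) : Prop :=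
  ∀ c u, c < s.radix m → u < s.radix m →
    s.nat 6 ((s.nat 0 0 * s.radix m + c) * s.radix m + u) = F c u

/-- Both selections are maximum searches for a total preorder `r` among the pairs with a positive
entry that satisfy `G`. The pair held at the start must be admissible, so that there is always a
current best one to compare with. -/
theorem scan_ensures (m : ℕ) (F : ℕ → ℕ → ℕ) (b : Test) (s₀ : State) (hF : FinalLayer m F s₀)
    (G : ℕ → ℕ → Prop) (r : ℕ → ℕ → ℕ → ℕ → Prop)
    (hb : ∀ s, Frame [11, 12, 13, 14] [] s₀ s →
      (b.Holds s ↔ G (s.nat 11 0) (s.nat 12 0) ∧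
        r (s.nat 13 0) (s.nat 14 0) (s.nat 11 0) (s.nat 12 0)))
    (hrefl : ∀ c u, r c u c u)
    (htrans : ∀ c u c' u' c'' u'', r c u c' u' → r c' u' c'' u'' → r c u c'' u'')
    (htotal : ∀ c u c' u', r c u c' u' ∨ r c' u' c u)
    (h13 : s₀.nat 13 0 < s₀.radix m) (h14 : s₀.nat 14 0 < s₀.radix m)
    (hpos : 0 < F (s₀.nat 13 0) (s₀.nat 14 0)) (hG : G (s₀.nat 13 0) (s₀.nat 14 0)) :
    Ensures (scan m b) (2 + s₀.radix m * ((2 + s₀.radix m * (4 + 2)) + 2)) (fun s =>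
      s.nat 13 0 < s₀.radix m ∧ s.nat 14 0 < s₀.radix m ∧
      0 < F (s.nat 13 0) (s.nat 14 0) ∧ G (s.nat 13 0) (s.nat 14 0) ∧
      ∀ c < s₀.radix m, ∀ u < s₀.radix m, 0 < F c u → G c u →
        r c u (s.nat 13 0) (s.nat 14 0)) s₀ := by
  refine (Ensures.forLoop₂ (N := s₀.radix m) (N' := s₀.radix m) (T := 4)
    (fun c u s => s.nat 13 0 < s₀.radix m ∧ s.nat 14 0 < s₀.radix m ∧
      0 < F (s.nat 13 0) (s.nat 14 0) ∧ G (s.nat 13 0) (s.nat 14 0) ∧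
      ∀ c' < s₀.radix m, ∀ u' < s₀.radix m, (c' < c ∨ (c' = c ∧ u' < u)) → 0 < F c' u' → G c' u' →
        r c' u' (s.nat 13 0) (s.nat 14 0)) ?_ ?_ ?_ ?_ ?_ ?_ ?_).mono le_rfl ?_
  · simp [forLoop, Prog.natWrites]
  · simp [Prog.natWrites]
  · rintro c u s a z (rfl | rfl) h <;> simpa [State.writeNat_nat] using h
  · intro s hs
    simp [radix, NExpr.val, nvar, State.radix, hs.1 0 (by simp [forLoop, Prog.natWrites])]
  · refine ⟨h13, h14, hpos, hG, fun c' _ u' _ h => by lia⟩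
  · rintro c u s hc hu hs hxc hyu ⟨i1, i2, i3, i4, i5⟩
    have e0 := hs.1 0 (by simp [forLoop, Prog.natWrites])
    have e6 := hs.1 6 (by simp [forLoop, Prog.natWrites])
    have hR : (radix m).val s = s₀.radix m := by simp [radix, NExpr.val, nvar, State.radix, e0]
    have hent : (entryFinal m).val s = F c u := by
      simp only [entryFinal, index, NExpr.val, hR, nvar, e0, hxc, hyu, e6]
      exact hF c u hc hu
    have hbs := hb s ⟨fun a ha => hs.1 a fun h => ha (by
      simp [forLoop, Prog.natWrites] at h
      simp only [List.mem_cons, List.not_mem_nil, or_false]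
      lia), fun a _ => hs.2 a (by simp [Prog.numWrites])⟩
    rw [hxc, hyu] at hbs
    refine Ensures.ite (N := 2) (N' := 1)
      (fun h => Ensures.seq (N := 1) (N' := 1) (Ensures.setNat (Ensures.setNat ?_)))
      (fun h => Ensures.skip ?_)
    · simp only [Test.Holds, hent, hbs] at h
      simp only [NExpr.val] at h
      obtain ⟨h1, h2, h3⟩ := h
      simp only [State.writeNat_nat, NExpr.val, nvar, hxc, hyu]
      norm_num
      refine ⟨hc, hu, h1, h2, fun c' hc' u' hu' h hpos hG => ?_⟩
      by_cases he : c' = c ∧ u' = u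
      · rw [he.1, he.2]
        exact hrefl c u
      · exact htrans _ _ _ _ _ _ (i5 c' hc' u' hu' (by lia) hpos hG) h3
    · simp only [Test.Holds, hent, hbs] at h
      simp only [NExpr.val] at h
      refine ⟨i1, i2, i3, i4, fun c' hc' u' hu' h' hpos hG => ?_⟩
      by_cases he : c' = c ∧ u' = u
      · obtain ⟨rfl, rfl⟩ := he
        exact (htotal _ _ _ _).resolve_right fun hr => h ⟨hpos, hG, hr⟩
      · exact i5 c' hc' u' hu' (by lia) hpos hG
  · rintro c s ⟨i1, i2, i3, i4, i5⟩
    exact ⟨i1, i2, i3, i4, fun c' hc' u' hu' h => i5 c' hc' u' hu' (by lia)⟩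
  · rintro s ⟨i1, i2, i3, i4, i5⟩
    exact ⟨i1, i2, i3, i4, fun c' hc' u' hu' => i5 c' hc' u' hu' (.inl hc')⟩

/-- Finds the largest rounded profit of a packing. -/
def scanProfit (m : ℕ) : Prog := scan m (.natLe (nvar 14) (nvar 12))

theorem scanProfit_ensures (m : ℕ) (F : ℕ → ℕ → ℕ) (s₀ : State) (hF : FinalLayer m F s₀)
    (h13 : s₀.nat 13 0 = 0) (h14 : s₀.nat 14 0 = 0) (hpos : 0 < F 0 0) :
    Ensures (scanProfit m) (2 + s₀.radix m * ((2 + s₀.radix m * (4 + 2)) + 2)) (fun s =>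
      s.nat 13 0 < s₀.radix m ∧ s.nat 14 0 < s₀.radix m ∧
      0 < F (s.nat 13 0) (s.nat 14 0) ∧
      ∀ c < s₀.radix m, ∀ u < s₀.radix m, 0 < F c u → u ≤ s.nat 14 0) s₀ := by
  refine (scan_ensures m F _ s₀ hF (fun _ _ => True) (fun _ u _ u' => u ≤ u') ?_ ?_ ?_ ?_ ?_ ?_ ?_
    trivial).mono le_rfl ?_
  · intro s _
    simp [Test.Holds, NExpr.val, nvar]
  · simp
  · intros; lia
  · intros; lia
  · rw [h13, State.radix]; lia
  · rw [h14, State.radix]; lia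
  · rwa [h13, h14]
  · rintro s ⟨h1, h2, h3, -, h4⟩
    exact ⟨h1, h2, h3, fun c hc u hu hp => h4 c hc u hu hp trivial⟩

/-- Finds the least number of nontrivial items among packings of almost maximum rounded
profit. -/
def scanCount (m : ℕ) : Prog :=
  scan m (.conj (.natLe (nvar 15) (.add (nvar 12) (nvar 0))) (.natLe (nvar 11) (nvar 13)))

theorem scanCount_ensures (m : ℕ) (F : ℕ → ℕ → ℕ) (s₀ : State) (hF : FinalLayer m F s₀)
    (h13 : s₀.nat 13 0 < s₀.radix m) (h14 : s₀.nat 14 0 < s₀.radix m)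
    (hpos : 0 < F (s₀.nat 13 0) (s₀.nat 14 0)) (h15 : s₀.nat 15 0 = s₀.nat 14 0) :
    Ensures (scanCount m) (2 + s₀.radix m * ((2 + s₀.radix m * (4 + 2)) + 2)) (fun s =>
      s.nat 13 0 < s₀.radix m ∧ s.nat 14 0 < s₀.radix m ∧
      0 < F (s.nat 13 0) (s.nat 14 0) ∧ s₀.nat 14 0 ≤ s.nat 14 0 + s₀.nat 0 0 ∧
      ∀ c < s₀.radix m, ∀ u < s₀.radix m, 0 < F c u → s₀.nat 14 0 ≤ u + s₀.nat 0 0 →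
        s.nat 13 0 ≤ c) s₀ := by
  refine scan_ensures m F _ s₀ hF (fun _ u => s₀.nat 14 0 ≤ u + s₀.nat 0 0)
    (fun c _ c' _ => c' ≤ c) ?_ ?_ ?_ ?_ h13 h14 hpos (by lia)
  · intro s hs
    simp [Test.Holds, NExpr.val, nvar, hs.1 15 (by simp), hs.1 0 (by simp), h15]
  · simp
  · intros; lia
  · intros; lia

/-! ### Backtracking -/

/-- The item that is inspected by the current step of the backtracking. -/
def backItem : NExpr := .sub (nvar 0) (.add (nvar 10) (.const 1))

/-- Decides on one item. -/
def backBody (m : ℕ) : Prog :=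
  .ite (.natLe (.get 6 (index m (.add backItem (.const 1)) (nvar 13) (nvar 14)))
      (.get 6 (index m backItem (nvar 13) (nvar 14))))
    .skip
    (.seq (.setNat 3 backItem (.const 1))
      (.seq (.setNat 13 (.const 0) (.sub (nvar 13) (.get 5 backItem)))
        (.setNat 14 (.const 0) (.sub (nvar 14) (.get 4 backItem)))))

/-- Reads a packing off the table, and writes it to natural array `3`. -/
def backLoop (m : ℕ) : Prog := forLoop 10 (nvar 0) (backBody m)

/-- Items are inspected from the last to the first. The current entry always equals the selected
entry plus the weight of the items taken so far, while the current pair is what remains of the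
counts. At layer zero the entry is positive, which forces the pair to be zero and the entry to be `B
+ 1`; the weight is then at most `B` because the selected entry is positive. -/
theorem backLoop_ensures (m : ℕ) (s₀ : State)
    (h6 : TableOn m s₀ (fun i _ _ => i ≤ s₀.nat 0 0) s₀) (h3 : ∀ i, s₀.nat 3 i = 0)
    (h13 : s₀.nat 13 0 < s₀.radix m) (h14 : s₀.nat 14 0 < s₀.radix m)
    (hpos : 0 < s₀.table (s₀.nat 0 0) (s₀.nat 13 0) (s₀.nat 14 0)) :
    Ensures (backLoop m) (2 + s₀.nat 0 0 * (5 + 2)) (fun s =>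
      ∃ S ⊆ Finset.range (s₀.nat 0 0), (∀ i, s.nat 3 i ≠ 0 ↔ i ∈ S) ∧
        ∑ i ∈ S, s₀.nat 2 i ≤ s₀.nat 1 0 ∧ ∑ i ∈ S, s₀.nat 5 i = s₀.nat 13 0 ∧
        ∑ i ∈ S, s₀.nat 4 i = s₀.nat 14 0) s₀ := by
  refine (Ensures.forLoop (N := s₀.nat 0 0) (T := 5) (fun j s => ∃ q, q + j = s₀.nat 0 0 ∧
      s.nat 13 0 < s₀.radix m ∧ s.nat 14 0 < s₀.radix m ∧
      ∃ S ⊆ Finset.range (s₀.nat 0 0), (∀ i ∈ S, q ≤ i) ∧ (∀ i, s.nat 3 i ≠ 0 ↔ i ∈ S) ∧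
        s₀.table q (s.nat 13 0) (s.nat 14 0) = s₀.table (s₀.nat 0 0) (s₀.nat 13 0) (s₀.nat 14 0) +
          ∑ i ∈ S, s₀.nat 2 i ∧
        s.nat 13 0 + ∑ i ∈ S, s₀.nat 5 i = s₀.nat 13 0 ∧
        s.nat 14 0 + ∑ i ∈ S, s₀.nat 4 i = s₀.nat 14 0) ?_ ?_ ?_ ?_ ?_).mono le_rfl ?_
  · simp [backBody, Prog.natWrites]
  · intro j s y h
    simpa [State.writeNat_nat] using h
  · intro s hF
    simp [NExpr.val, nvar, hF.1 0 (by simp [backBody, Prog.natWrites])]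
  · exact ⟨_, rfl, h13, h14, ∅, by simp, by simp, by simp [h3], by simp, by simp, by simp⟩
  · rintro j s hj hF hx ⟨q, hq, i13, i14, S, hS, hSq, hout, hT, ht, hv⟩
    obtain ⟨q, rfl⟩ : ∃ q', q = q' + 1 := ⟨q - 1, by lia⟩
    have e0 := hF.1 0 (by simp [backBody, Prog.natWrites])
    have e4 := hF.1 4 (by simp [backBody, Prog.natWrites])
    have e5 := hF.1 5 (by simp [backBody, Prog.natWrites])
    have e6 := hF.1 6 (by simp [backBody, Prog.natWrites])
    have hR : (radix m).val s = s₀.radix m := by simp [radix, NExpr.val, nvar, State.radix, e0]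
    have hitem : backItem.val s = q := by
      simp only [backItem, NExpr.val, nvar, e0, hx]
      lia
    have hb' : ∀ k c u, k ≤ s₀.nat 0 0 → c < s₀.radix m → u < s₀.radix m →
        s₀.nat 6 ((k * s₀.radix m + c) * s₀.radix m + u) = s₀.table k c u :=
      fun k c u hk hc hu => h6 k c u hc hu hk
    have hqS : q ∉ S := fun h => by have := hSq q h; lia
    refine Ensures.ite (N := 1) (N' := 3) (fun hb => Ensures.skip ?_) (fun hb =>
      Ensures.seq (N := 1) (N' := 2) (Ensures.setNat
        (Ensures.seq (N := 1) (N' := 1) (Ensures.setNat (Ensures.setNat ?_)))))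
    all_goals
      simp only [Test.Holds, index, NExpr.val, hR, hitem, nvar, e6] at hb
      rw [hb' _ _ _ (by lia) i13 i14, hb' _ _ _ (by lia) i13 i14] at hb
    · refine ⟨q, by lia, i13, i14, S, hS, fun i hi => (Nat.le_succ q).trans (hSq i hi), hout, ?_,
        ht, hv⟩
      rw [← hT]
      -- Leaving out an item never raises the entry of a layer above the next one, so the test
      -- amounts to equality.
      refine le_antisymm ?_ hb
      unfold State.table
      conv_rhs => rw [OfflineKnap.table]
      split_ifs
      · exact le_max_left _ _
      · exact le_rfl
    -- The entry strictly exceeds the one without item `q`, so the item was taken. Being positive,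
    -- the difference is not truncated, and the weight of `q` can be added back.
    · have hrec : (s₀.nat 5 q ≤ s.nat 13 0 ∧ s₀.nat 4 q ≤ s.nat 14 0) ∧
          s₀.table (q + 1) (s.nat 13 0) (s.nat 14 0) =
            s₀.table q (s.nat 13 0 - s₀.nat 5 q) (s.nat 14 0 - s₀.nat 4 q) - s₀.nat 2 q := by
        unfold State.table at hb ⊢
        rw [OfflineKnap.table] at hb ⊢
        split_ifs at hb ⊢ with hif
        · refine ⟨hif, ?_⟩
          rw [max_eq_right]
          by_contra hlt
          exact hb (by rw [max_eq_left (not_le.1 hlt).le])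
        · exact absurd le_rfl hb
      have hitem' : ∀ s' : State, s'.nat 0 = s.nat 0 → s'.nat 10 = s.nat 10 →
          backItem.val s' = q := by
        intro s' h0 h10
        rw [← hitem]
        simp only [backItem, NExpr.val, nvar, h0, h10]
      have w1 : ∀ (s' : State) (a i x b : ℕ), b ≠ a → (s'.writeNat a i x).nat b = s'.nat b := by
        intro s' a i x b hab
        funext k
        rw [State.writeNat_nat, if_neg (fun h => hab h.1)]
      have hit1 := hitem' (s.writeNat 3 q 1) (w1 _ _ _ _ _ (by lia)) (w1 _ _ _ _ _ (by lia))
      simp only [NExpr.val, hitem, hit1, nvar]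
      rw [hitem' _ (by rw [w1 _ _ _ _ _ (by lia), w1 _ _ _ _ _ (by lia)])
        (by rw [w1 _ _ _ _ _ (by lia), w1 _ _ _ _ _ (by lia)])]
      simp only [State.writeNat_nat]
      norm_num
      simp only [e5, e4]
      refine ⟨q, by lia, by lia, by lia, insert q S, ?_, ?_, ?_, ?_, ?_, ?_⟩
      · exact Finset.insert_subset (Finset.mem_range.2 (by lia)) hS
      · intro i hi
        rcases Finset.mem_insert.1 hi with rfl | hi
        · exact le_rfl
        · have := hSq i hi
          lia
      · intro i
        rw [Finset.mem_insert, ← hout i]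
        by_cases hi : i = q <;> simp [hi]
      all_goals rw [Finset.sum_insert hqS]; lia
  · rintro s ⟨q, hq, i13, i14, S, hS, hSq, hout, hT, ht, hv⟩
    obtain rfl : q = 0 := by lia
    refine ⟨S, hS, hout, ?_⟩
    unfold State.table at hT hpos
    rw [show OfflineKnap.table (s₀.nat 1 0) (s₀.nat 2) (s₀.nat 5) (s₀.nat 4) 0 (s.nat 13 0)
      (s.nat 14 0) = if s.nat 13 0 = 0 ∧ s.nat 14 0 = 0 then s₀.nat 1 0 + 1 else 0 from rfl] at hT
    split_ifs at hT with hif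
    · lia
    · lia

/-! ### The algorithm -/

/-- The approximation algorithm with accuracy `2 / m`. -/
def knapProg (m : ℕ) : Prog :=
  .seq maxLoop (.seq (roundLoop m) (.seq (fillLoop m) (.seq (scanProfit m)
    (.seq (.setNat 15 (.const 0) (nvar 14)) (.seq (scanCount m) (backLoop m))))))

/-- A bound for the number of steps of `knapProg m` on `n` items. -/
def stepBound (m n : ℕ) : ℕ :=
  let R := m * n * n + 1
  (2 + n * (3 + 2)) +
    ((2 + n * (3 + (1 + ((2 + m * n * (1 + 2)) + (1 + (2 + m * n * (4 + 2))))) + 2)) +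
      ((1 + (2 + n * (2 + R * ((2 + R * (3 + 2)) + 2) + 2))) +
        ((2 + R * ((2 + R * (4 + 2)) + 2)) +
          (1 + ((2 + R * ((2 + R * (4 + 2)) + 2)) + (2 + n * (5 + 2)))))))

theorem output_map_val (K : KnapInstance) {s : State} {S : Finset ℕ} (hS : S ⊆ Finset.range K.n)
    (h : ∀ i, s.nat 3 i ≠ 0 ↔ i ∈ S) : (K.output s).map Fin.valEmbedding = S := by
  ext j
  simp only [KnapInstance.output, Finset.mem_map, Finset.mem_filter, Finset.mem_univ, true_and,
    Fin.valEmbedding_apply]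
  constructor
  · rintro ⟨i, hi, rfl⟩
    exact (h i).1 hi
  · intro hj
    exact ⟨⟨j, Finset.mem_range.1 (hS hj)⟩, (h j).2 hj, rfl⟩

theorem knapProg_ensures {ε : ℝ} (hε : 0 < ε) {m : ℕ} (hm : 2 / ε ≤ m) (K : KnapInstance) :
    Ensures (knapProg m) (stepBound m K.n) (fun s => IsSmallPacking ε K (K.output s)) K.input := by
  have hn : K.input.nat 0 0 = K.n := rfl
  have hB : K.input.nat 1 0 = K.B := rfl
  have hw : K.input.nat 2 = KnapInstance.extend K.w := rfl
  have hp : K.input.num 0 = KnapInstance.extend K.p := rfl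
  have hlo : K.input.num 1 = KnapInstance.extend K.lo := rfl
  have hhi : K.input.num 2 = KnapInstance.extend K.hi := rfl
  have hzero : ∀ a, 3 ≤ a → ∀ i, K.input.nat a i = 0 := fun a ha i => by
    simp only [KnapInstance.input]
    rw [if_neg (by lia), if_neg (by lia), if_neg (by lia)]
  have hpext : ∀ i < K.n, ∃ h : i < K.n, KnapInstance.extend K.p i = K.p ⟨i, h⟩ := fun i hi =>
    ⟨hi, dif_pos hi⟩
  have hp0 : ∀ i < K.n, 0 ≤ KnapInstance.extend K.p i := fun i hi => by
    obtain ⟨h, e⟩ := hpext i hi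
    rw [e]
    exact K.p_nonneg _
  -- the largest profit
  refine Ensures.seq ((maxLoop_ensures K.input rfl).frame.mono (by rw [hn]) ?_)
  rw [hn, hp]
  rintro s₁ ⟨hF₁, hmax, hattain⟩
  have a0 : ∀ a, a ≠ 10 → s₁.nat a = K.input.nat a := fun a ha => hF₁.1 a (by
    simpa [maxLoop, forLoop, Prog.natWrites] using ha)
  have b0 : ∀ a, a ≠ 3 → s₁.num a = K.input.num a := fun a ha => hF₁.2 a (by
    simpa [maxLoop, forLoop, Prog.numWrites] using ha)
  have hpm : 0 ≤ s₁.num 3 0 := by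
    rcases hattain with h | ⟨i, hi, h⟩
    · exact h.ge
    · exact h ▸ hp0 i hi
  -- Each single item is a packing, since every weight is at most `B`.
  have hpm' : s₁.num 3 0 ≤ K.optProfit := by
    rcases hattain with h | ⟨i, hi, h⟩
    · exact h ▸ K.optProfit_nonneg
    · obtain ⟨hi, e⟩ := hpext i hi
      rw [h, e]
      exact K.p_le_optProfit _
  -- rounding
  have hround := roundLoop_ensures m s₁
    (by rw [a0 0 (by lia), b0 0 (by lia), hn, hp]; exact hp0)
    (by rw [a0 0 (by lia), b0 0 (by lia), hn, hp]; exact hmax)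
    (by rw [a0 4 (by lia)]; exact hzero 4 (by lia)) (by rw [a0 5 (by lia)]; exact hzero 5 (by lia))
  rw [a0 0 (by lia), hn, b0 0 (by lia), hp, b0 1 (by lia), hlo, b0 2 (by lia), hhi] at hround
  refine Ensures.seq (hround.frame.mono le_rfl ?_)
  rintro s₂ ⟨hF₂, ht, ht', hv⟩
  have a1 : ∀ a, a ≠ 10 → a ≠ 11 → a ≠ 4 → a ≠ 5 → s₂.nat a = K.input.nat a :=
    fun a h1 h2 h3 h4 => by
      rw [hF₂.1 a (by
        simp [roundLoop, roundBody, countLoop, scaleLoop, forLoop, Prog.natWrites]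
        lia), a0 a h1]
  have ht2 : s₂.nat 5 = K.nontriv := by
    funext i
    by_cases hi : i < K.n
    · exact ht i hi
    · rw [ht' i (by lia)]
      simp [KnapInstance.nontriv, KnapInstance.extend, hi]
  -- the table
  have hfill := fillLoop_ensures m s₂
    (by rw [a1 6 (by lia) (by lia) (by lia) (by lia)]; exact hzero 6 (by lia))
  have hn2 : s₂.nat 0 0 = K.n := by rw [a1 0 (by lia) (by lia) (by lia) (by lia), hn]
  have hB2 : s₂.nat 1 0 = K.B := by rw [a1 1 (by lia) (by lia) (by lia) (by lia), hB]
  have hw2 : s₂.nat 2 = KnapInstance.extend K.w := by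
    rw [a1 2 (by lia) (by lia) (by lia) (by lia), hw]
  have hR2 : s₂.radix m = m * K.n * K.n + 1 := by rw [State.radix, hn2]
  rw [hn2, hR2] at hfill
  refine Ensures.seq (hfill.frame.mono le_rfl ?_)
  rintro s₃ ⟨hF₃, h6⟩
  have a2 : ∀ a, a ≠ 10 → a ≠ 11 → a ≠ 12 → a ≠ 6 → s₃.nat a = s₂.nat a :=
    fun a h1 h2 h3 h4 => hF₃.1 a (by
      simp [fillLoop, fillLayer, fillBody, forLoop, Prog.natWrites]
      lia)
  have hn3 : s₃.nat 0 0 = K.n := by rw [a2 0 (by lia) (by lia) (by lia) (by lia), hn2]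
  have hR3 : s₃.radix m = m * K.n * K.n + 1 := by rw [State.radix, hn3]
  set F := table K.B (KnapInstance.extend K.w) K.nontriv (s₂.nat 4) with hFdef
  have hT2 : s₂.table = F := by unfold State.table; rw [hB2, hw2, ht2]
  have h6' : ∀ i c u, c < m * K.n * K.n + 1 → u < m * K.n * K.n + 1 → i ≤ K.n →
      s₃.nat 6 ((i * (m * K.n * K.n + 1) + c) * (m * K.n * K.n + 1) + u) = F i c u := by
    intro i c u hc hu hi
    have := h6 i c u (by rwa [hR2]) (by rwa [hR2]) hi
    rwa [hR2, hT2] at this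
  have hlay : ∀ s : State, s.nat 0 = s₃.nat 0 → s.nat 6 = s₃.nat 6 → FinalLayer m (F K.n) s := by
    intro s e0 e6 c u hc hu
    have hR : s.radix m = m * K.n * K.n + 1 := by rw [State.radix, e0, hn3]
    rw [hR] at hc hu ⊢
    rw [e6, e0, hn3]
    exact h6' _ _ _ hc hu le_rfl
  -- The empty packing makes the pair `(0, 0)`, which the zeroed cells `13` and `14` hold, an
  -- admissible start of the first scan.
  have hF00 : 0 < F K.n 0 0 := by
    have := le_table (B := K.B) (w := KnapInstance.extend K.w) (t := K.nontriv) (v := s₂.nat 4)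
      K.n ∅ (by simp)
    simp only [Finset.sum_empty] at this
    lia
  -- the selection
  have hscan := scanProfit_ensures m (F K.n) s₃ (hlay _ rfl rfl)
    (by rw [a2 13 (by lia) (by lia) (by lia) (by lia), a1 13 (by lia) (by lia) (by lia) (by lia)]
        exact hzero 13 (by lia) 0)
    (by rw [a2 14 (by lia) (by lia) (by lia) (by lia), a1 14 (by lia) (by lia) (by lia) (by lia)]
        exact hzero 14 (by lia) 0) hF00
  rw [hR3] at hscan
  refine Ensures.seq (hscan.frame.mono le_rfl ?_)
  rintro s₄ ⟨hF₄, c13, c14, cpos, cmax⟩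
  have a3 : ∀ a, a ≤ 10 → s₄.nat a = s₃.nat a :=
    fun a h1 => hF₄.1 a (by
      simp [scanProfit, scan, forLoop, Prog.natWrites]
      lia)
  -- The second scan overwrites cell `14`, so the value `V` is saved in cell `15`.
  refine Ensures.seq (Ensures.setNat ?_)
  simp only [NExpr.val, nvar]
  set s₅ := s₄.writeNat 15 0 (s₄.nat 14 0) with hs₅
  have a4 : ∀ a, a ≠ 15 → s₅.nat a = s₄.nat a := fun a ha => by
    funext i
    rw [hs₅, State.writeNat_nat, if_neg (fun h => ha h.1)]
  have hn5 : s₅.nat 0 0 = K.n := by rw [a4 0 (by lia), a3 0 (by lia), hn3]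
  have hR5 : s₅.radix m = m * K.n * K.n + 1 := by rw [State.radix, hn5]
  have hcount := scanCount_ensures m (F K.n) s₅
    (hlay _ (by rw [a4 0 (by lia), a3 0 (by lia)]) (by rw [a4 6 (by lia), a3 6 (by lia)]))
    (by rwa [a4 13 (by lia), hR5]) (by rwa [a4 14 (by lia), hR5])
    (by rwa [a4 13 (by lia), a4 14 (by lia)])
    (by rw [a4 14 (by lia), hs₅, State.writeNat_nat]; simp)
  rw [hR5, hn5, a4 14 (by lia)] at hcount
  refine Ensures.seq (hcount.frame.mono le_rfl ?_)
  rintro s₆ ⟨hF₆, d13, d14, dpos, dle, dmin⟩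
  have a5 : ∀ a, a < 10 → s₆.nat a = s₃.nat a :=
    fun a h1 => by
      rw [hF₆.1 a (by
        simp [scanCount, scan, forLoop, Prog.natWrites]
        lia), a4 a (by lia), a3 a (by lia)]
  have a6 : ∀ a, a < 6 → s₆.nat a = s₂.nat a := fun a ha => by
    rw [a5 a (by lia), a2 a (by lia) (by lia) (by lia) (by lia)]
  have hn6 : s₆.nat 0 0 = K.n := by rw [a6 0 (by lia), hn2]
  have hR6 : s₆.radix m = m * K.n * K.n + 1 := by rw [State.radix, hn6]
  have hT6 : s₆.table = F := by
    rw [← hT2]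
    unfold State.table
    rw [a6 1 (by lia), a6 2 (by lia), a6 4 (by lia), a6 5 (by lia)]
  -- backtracking
  have hback := backLoop_ensures m s₆
    (by
      intro i c u hc hu hi
      rw [hR6] at hc hu ⊢
      rw [a5 6 (by lia), hT6]
      exact h6' i c u hc hu (by rwa [hn6] at hi))
    (by
      rw [a6 3 (by lia), a1 3 (by lia) (by lia) (by lia) (by lia)]
      exact hzero 3 le_rfl)
    (by rwa [hR6]) (by rwa [hR6]) (by rwa [hT6, hn6])
  rw [hn6, a6 1 (by lia), hB2, a6 2 (by lia), hw2, a6 5 (by lia), ht2, a6 4 (by lia)] at hback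
  refine hback.mono le_rfl ?_
  rintro s ⟨S, hS, hout, hSw, hSt, hSv⟩
  have hmap := output_map_val K hS hout
  refine isSmallPacking_of_selection K hε hm hpm hpm' hv (c₀ := s₆.nat 13 0) (V := s₄.nat 14 0)
    ⟨_, cpos⟩ cmax dmin ?_ ?_ ?_
  · rwa [hmap]
  · rwa [hmap]
  · rwa [hmap, hSv]

/-- Products occur only in loop bounds and array indices, never in a stored natural number. -/
theorem knapProg_additive (m : ℕ) : (knapProg m).Additive := by
  simp [knapProg, maxLoop, roundLoop, roundBody, scaleLoop, countLoop, fillLoop, fillLayer, fillBody,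
    scanProfit, scanCount, scan, backLoop, backBody, forLoop, Prog.Additive, NExpr.Additive, nvar,
    entryTake, entrySkip]

/-! ### Lengths of real numbers -/

theorem lengthControl_unitSize : LengthControl unitSize 1 fun _ _ => True where
  mono _ _ := trivial
  zero _ := trivial
  add _ _ := trivial
  sub _ _ := trivial
  size_le _ := by unfold unitSize; lia

/-- Fractions with denominator `D` whose numerator has at most `S` digits. -/
def IsFraction (D S : ℕ) (x : ℝ) : Prop := ∃ a : ℤ, x = a / D ∧ Nat.size a.natAbs ≤ S

theorem size_natAbs_add_le {a b : ℤ} {S : ℕ} (ha : Nat.size a.natAbs ≤ S)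
    (hb : Nat.size b.natAbs ≤ S) : Nat.size (a + b).natAbs ≤ S + 1 :=
  (Nat.size_le_size (Int.natAbs_add_le a b)).trans
    ((size_add_le _ _).trans (Nat.add_le_add_right (max_le ha hb) 1))

/-- Over a fixed denominator only the numerators grow, by one bit per operation. Passing to lowest
terms can only shorten a fraction; the constant pays for the sign bit and the denominator. -/
theorem lengthControl_bitSize {D : ℕ} (hD : 0 < D) :
    LengthControl bitSize (1 + Nat.size D) (IsFraction D) where
  mono hS h := by
    obtain ⟨a, h1, h2⟩ := h
    exact ⟨a, h1, h2.trans hS⟩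
  zero S := ⟨0, by simp, by simp⟩
  add h h' := by
    obtain ⟨a, rfl, ha⟩ := h
    obtain ⟨b, rfl, hb⟩ := h'
    exact ⟨a + b, by push_cast; ring, size_natAbs_add_le ha hb⟩
  sub h h' := by
    obtain ⟨a, rfl, ha⟩ := h
    obtain ⟨b, rfl, hb⟩ := h'
    exact ⟨a - b, by push_cast; ring, by
      rw [sub_eq_add_neg]
      exact size_natAbs_add_le ha (by rwa [Int.natAbs_neg])⟩
  size_le h := by
    obtain ⟨a, rfl, ha⟩ := h
    have e : (a : ℝ) / D = ((a / (D : ℤ) : ℚ) : ℝ) := by push_cast; rfl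
    rw [e, bitSize_ratCast, ratSize]
    have hD' : (D : ℤ) ≠ 0 := by exact_mod_cast hD.ne'
    have hnum : ((a / (D : ℤ) : ℚ)).num.natAbs ≤ a.natAbs := by
      by_cases h0 : a = 0
      · simp [h0]
      · refine Nat.le_of_dvd (Int.natAbs_pos.2 h0) (Int.natAbs_dvd_natAbs.2 ?_)
        exact_mod_cast Rat.num_dvd a hD'
    have hden : ((a / (D : ℤ) : ℚ)).den ≤ D := by
      refine Nat.le_of_dvd hD ?_
      exact_mod_cast Rat.den_dvd a D
    have h1 := Nat.size_le_size hnum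
    have h2 := Nat.size_le_size hden
    lia

theorem isFraction_of_den_dvd {D : ℕ} (hD : 0 < D) {q : ℚ} (h : q.den ∣ D) :
    IsFraction D (ratSize q + Nat.size D) q := by
  obtain ⟨k, rfl⟩ := h
  refine ⟨q.num * k, ?_, ?_⟩
  · have hk : (k : ℝ) ≠ 0 := by
      rintro h
      have : k = 0 := by exact_mod_cast h
      simp [this] at hD
    have hd : (q.den : ℝ) ≠ 0 := by exact_mod_cast q.den_nz
    have : (q : ℝ) = (q.num : ℝ) / q.den := by exact_mod_cast (Rat.num_div_den q).symm
    rw [this]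
    push_cast
    field_simp
  · rw [Int.natAbs_mul, Int.natAbs_natCast]
    have h1 := size_mul_le q.num.natAbs k
    have h2 := Nat.size_le_size (Nat.le_mul_of_pos_left k q.den_pos)
    unfold ratSize
    lia

theorem size_prod_le {ι : Type*} (s : Finset ι) (f : ι → ℕ) :
    Nat.size (∏ i ∈ s, f i) ≤ ∑ i ∈ s, Nat.size (f i) + 1 := by
  classical
  induction s using Finset.induction_on with
  | empty => simp
  | insert i s hi ih =>
    rw [Finset.prod_insert hi, Finset.sum_insert hi]
    have := size_mul_le (f i) (∏ i ∈ s, f i)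
    lia

namespace KnapInstance

variable (K : KnapInstance) (size : ℝ → ℕ)

theorem size_item_le_length (i : Fin K.n) :
    Nat.size (K.w i) + size (K.p i) + size (K.lo i) + size (K.hi i) ≤ K.length size := by
  have := Finset.single_le_sum
    (f := fun i => Nat.size (K.w i) + size (K.p i) + size (K.lo i) + size (K.hi i))
    (fun _ _ => Nat.zero_le _) (Finset.mem_univ i)
  unfold length
  lia

theorem input_nat_size_le (a i : ℕ) : Nat.size (K.input.nat a i) ≤ K.length size := by
  have hn : Nat.size K.n ≤ K.length size := (size_le_self _).trans (by unfold length; lia)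
  simp only [input]
  split_ifs
  · exact hn
  · unfold length
    lia
  · unfold extend
    split_ifs with h
    · have := K.size_item_le_length size ⟨i, h⟩
      lia
    · simp
  · simp

theorem input_num_induction {P : ℝ → Prop} (h0 : P 0) (hp : ∀ i, P (K.p i))
    (hlo : ∀ i, P (K.lo i)) (hhi : ∀ i, P (K.hi i)) (a i : ℕ) : P (K.input.num a i) := by
  simp only [input, extend]
  split_ifs <;> first | exact h0 | exact hp _ | exact hlo _ | exact hhi _

theorem input_bounded_unitSize :
    K.input.Bounded (fun _ _ => True) (2 * K.length unitSize + 1) :=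
  ⟨fun a i => (K.input_nat_size_le unitSize a i).trans (by lia), fun _ _ => trivial⟩

/-- Rational data have a common denominator of polynomial length. -/
theorem IsRational.exists_bounded {K : KnapInstance} (h : K.IsRational) :
    ∃ D : ℕ, 0 < D ∧ Nat.size D ≤ K.length bitSize + 1 ∧
      K.input.Bounded (IsFraction D) (2 * K.length bitSize + 1) := by
  choose hp hlo hhi using h
  choose p hp using hp
  choose lo hlo using hlo
  choose hi hhi using hhi
  -- The product of all denominators: its length is at most the sum of their lengths plus one, and
  -- these are part of the input length.
  set D := ∏ i, ((p i).den * (lo i).den * (hi i).den) with hDdef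
  have hD : 0 < D := Finset.prod_pos fun i _ => by
    have := (p i).den_pos
    have := (lo i).den_pos
    have := (hi i).den_pos
    positivity
  have hdvd : ∀ i, (p i).den * (lo i).den * (hi i).den ∣ D := fun i =>
    Finset.dvd_prod_of_mem (fun i => (p i).den * (lo i).den * (hi i).den) (Finset.mem_univ i)
  have hsize : Nat.size D ≤ K.length bitSize + 1 := by
    refine (size_prod_le _ _).trans (Nat.add_le_add_right ?_ 1)
    refine le_trans (Finset.sum_le_sum fun i _ => ?_) (Nat.le_add_left _ _)
    rw [← hp, ← hlo, ← hhi, bitSize_ratCast, bitSize_ratCast, bitSize_ratCast]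
    have h1 := size_mul_le ((p i).den * (lo i).den) (hi i).den
    have h2 := size_mul_le (p i).den (lo i).den
    unfold ratSize
    lia
  refine ⟨D, hD, hsize, fun a i => (K.input_nat_size_le bitSize a i).trans (by lia), ?_⟩
  have hL := lengthControl_bitSize hD
  -- Expanding `q` to the denominator `D` gives a numerator of length at most `ratSize q + Nat.size
  -- D`, whence twice the input length plus one.
  have key : ∀ q : ℚ, q.den ∣ D → bitSize q ≤ K.length bitSize →
      IsFraction D (2 * K.length bitSize + 1) q := fun q hq hle =>
    hL.mono (by rw [bitSize_ratCast] at hle; lia) (isFraction_of_den_dvd hD hq)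
  refine K.input_num_induction (hL.zero _) ?_ ?_ ?_
  all_goals
    intro i
    have hle := K.size_item_le_length bitSize i
    have hd := hdvd i
  · rw [← hp]
    exact key _ (((Dvd.intro _ rfl).trans (Dvd.intro _ rfl)).trans hd) (by rw [hp]; lia)
  · rw [← hlo]
    exact key _ (((Dvd.intro_left _ rfl).trans (Dvd.intro _ rfl)).trans hd) (by rw [hlo]; lia)
  · rw [← hhi]
    exact key _ ((Dvd.intro_left _ rfl).trans hd) (by rw [hhi]; lia)

end KnapInstance

/-! ### Running time -/

theorem stepBound_mono {m n n' : ℕ} (h : n ≤ n') : stepBound m n ≤ stepBound m n' := by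
  unfold stepBound
  dsimp only
  gcongr

open Polynomial in
/-- The number of steps is polynomial in the number of items. -/
theorem exists_polynomial_stepBound (m : ℕ) : ∃ p : ℕ[X], ∀ n, p.eval n = stepBound m n :=
  ⟨let R : ℕ[X] := (m : ℕ[X]) * X * X + 1;
    (2 + X * (3 + 2)) +
      ((2 + X * (3 + (1 + ((2 + (m : ℕ[X]) * X * (1 + 2)) +
          (1 + (2 + (m : ℕ[X]) * X * (4 + 2))))) + 2)) +
        ((1 + (2 + X * (2 + R * ((2 + R * (3 + 2)) + 2) + 2))) +
          ((2 + R * ((2 + R * (4 + 2)) + 2)) +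
            (1 + ((2 + R * ((2 + R * (4 + 2)) + 2)) + (2 + X * (5 + 2))))))),
    fun n => by simp [stepBound]⟩

open Polynomial in
theorem solvesInPolyTime_knapProg {ε : ℝ} (hε : 0 < ε) {m : ℕ} (hm : 2 / ε ≤ m)
    (size : ℝ → ℕ) (dom : KnapInstance → Prop)
    (h : ∀ K, dom K → ∃ d Len, d ≤ K.length size + 2 ∧ LengthControl size d Len ∧
      K.input.Bounded Len (2 * K.length size + 1)) :
    SolvesInPolyTime size dom (IsSmallPacking ε) (knapProg m) := by
  obtain ⟨p, hp⟩ := exists_polynomial_stepBound m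
  set W := (knapProg m).width with hW
  -- The bound of `Run.exists_exec` with `k` replaced by `p`, the initial `S` by `2 * X + 1` and `d`
  -- by `X + 2`.
  refine ⟨p * ((W : ℕ[X]) * (1 + (W : ℕ[X]) * (2 * X + 1 + (W : ℕ[X]) * p + 1) + (X + 2))), ?_⟩
  intro K hK
  obtain ⟨d, Len, hd, hL, hb⟩ := h K hK
  obtain ⟨k, s, hrun, hk, hgoal⟩ := knapProg_ensures hε hm K
  obtain ⟨⟨t, ht, hle⟩, -⟩ := hrun.exists_exec hL (knapProg_additive m) hW.ge hb
  refine ⟨t, s, ht, hle.trans ?_, hgoal⟩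
  have hn : K.n ≤ K.length size := by unfold KnapInstance.length; lia
  have hk' := hk.trans (stepBound_mono (m := m) hn)
  rw [← hp] at hk'
  simp only [eval_mul, eval_add, eval_natCast, eval_one, eval_X, eval_ofNat, Nat.cast_id]
  unfold opCost
  gcongr

end OfflineKnap

theorem mainTheorem10 (ε : ℝ) (hε : 0 < ε) :
    ∃ A : OfflineKnap.Prog,
      OfflineKnap.SolvesInPolyTime OfflineKnap.bitSize OfflineKnap.KnapInstance.IsRational
          (OfflineKnap.IsSmallPacking ε) A ∧
        OfflineKnap.SolvesInPolyTime OfflineKnap.unitSize (fun _ => True)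
          (OfflineKnap.IsSmallPacking ε) A := by
  -- The program depends on `ε` only through `m`, and so it is the same for both cost models.
  obtain ⟨m, hm⟩ := exists_nat_ge (2 / ε)
  refine ⟨OfflineKnap.knapProg m, OfflineKnap.solvesInPolyTime_knapProg hε hm _ _ fun K hK => ?_,
    OfflineKnap.solvesInPolyTime_knapProg hε hm _ _ fun K _ => ?_⟩
  · obtain ⟨D, hD, hsize, hb⟩ := hK.exists_bounded
    exact ⟨_, _, by lia, OfflineKnap.lengthControl_bitSize hD, hb⟩
  · exact ⟨1, _, by lia, OfflineKnap.lengthControl_unitSize, K.input_bounded_unitSize⟩
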